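/- Let $R$ be a complete regular local commutative ring of dimension $\ge 2$ whose residue field is algebraically closed of characteristic zero. Let $B$ be a regular $R$-algebra: an $R$-algebra that is free and finitely generated as an $R$-module, has centre $R$, and satisfies $\operatorname{gl.dim} B=\dim R$. Let $0\neq f\in R$ and put $A=B/(f)$ and $$B[\sqrt f]=B[z]/(z^2-f)=R[\sqrt f]\otimes_R B .$$ Let $G_f=\langle\sigma\rangle$ be the cyclic group of order $2$, acting on $B[\sqrt f]$ by $\sigma(z)=-z$ and trivially on $B$; let $\Lambda=B[\sqrt f]*G_f$ be the skew group ring, and let $\varepsilon=\tfrac12(1-\sigma)\in\Lambda$, an idempotent. For an algebra $L$ that is finitely generated as a module over a commutative Noetherian local ring $S$, let $\mathrm{MCM}\,L$ be the category of maximal Cohen--Macaulay $L$-modules, i.e. finitely generated left $L$-modules $M$ with $\operatorname{depth}_S M=\dim S$, together with $M=0$; here $S=R$ for $L=\Lambda$ and $S=R/(f)$ for $L=A$ (if $f$ is a unit then $A=0$ and $\mathrm{MCM}\,A$ consists of zero modules). Say that $L$ has finite representation type if it has only finitely many indecomposable maximal Cohen--Macaulay modules up to isomorphism. Let $\underline{\mathrm{MCM}}\,\Lambda=(\mathrm{MCM}\,\Lambda)/\langle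 B[\sqrt f]\rangle$ be the quotient of $\mathrm{MCM}\,\Lambda$ by the ideal of morphisms that factor through a finite direct sum of copies of the $\Lambda$-module $B[\sqrt f]\simeq\Lambda(1-\varepsilon)$, and let $\underline{\mathrm{Hom}}_\Lambda(X,M)$ denote $\mathrm{Hom}_\Lambda(X,M)$ modulo such morphisms. The group $\underline{\mathrm{Hom}}_\Lambda(\Lambda\varepsilon,M)$ is an $A$-module: the class of $b\in B$ acts by precomposition with right multiplication by $b$ on $\Lambda\varepsilon$. Then $\underline{\mathrm{Hom}}_\Lambda(\Lambda\varepsilon,M)$ is a maximal Cohen--Macaulay $A$-module for every maximal Cohen--Macaulay $\Lambda$-module $M$, and the functor $$\underline{\mathrm{Hom}}_\Lambda(\Lambda\varepsilon,-)\colon\ \underline{\mathrm{MCM}}\,\Lambda\longrightarrow \mathrm{MCM}\,A$$ is an equivalence of categories. Moreover, $A$ has finite representation type if and only if $\Lambda$ does. -/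

import Mathlib

open CategoryTheory
open scoped TensorProduct

universe u

noncomputable section

namespace Knoerrer

/-! ### Depth, maximal Cohen-Macaulay modules, finite representation type, regular algebras -/

section General

/-- The depth of an `R`-module: the supremum of the lengths of `M`-regular sequences
(`IsRegular` includes `M ≠ (r₁, …, rₙ) M`, so over a local ring `R`, for `M` finitely generated,
the members of such a sequence lie in the maximal ideal).  It is `⊥` for the zero module. -/
def depth (R : Type*) [CommRing R] (M : Type*) [AddCommGroup M] [Module R M] : WithBot ℕ∞ :=
  ⨆ rs : {rs : List R // RingTheory.Sequence.IsRegular M rs}, (rs.1.length : WithBot ℕ∞)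

variable (R : Type u) [CommRing R] (L : Type u) [Ring L] [Algebra R L]

/-- Maximal Cohen-Macaulay modules over an `R`-algebra `L`: finitely generated left `L`-modules `M`
with `depth_R M = dim R`; the zero module is included, as usual. -/
def isMCM : ObjectProperty (ModuleCat.{u} L) := fun M =>
  letI : Module R M := Module.compHom M (algebraMap R L)
  Module.Finite L M ∧ (Subsingleton M ∨ depth R M = ringKrullDim R)

/-- The category of maximal Cohen-Macaulay `L`-modules. -/
abbrev MCM := (isMCM R L).FullSubcategory

/-- Up to isomorphism there are only finitely many indecomposable maximal Cohen-Macaulay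
`L`-modules. -/
def HasFiniteRepresentationType : Prop :=
  {c : _root_.Quotient (isIsomorphicSetoid (ModuleCat.{u} L)) |
    ∃ M : ModuleCat.{u} L, isMCM R L M ∧ Indecomposable M ∧ c = ⟦M⟧}.Finite

/-- The (left) global dimension of a ring. -/
def globalDimension (L : Type u) [Ring L] : WithBot ℕ∞ :=
  ⨆ M : ModuleCat.{u} L, projectiveDimension M

/-- Regular `R`-algebras over a regular local ring `R`: module-finite, with centre `R`, free as an
`R`-module, and of global dimension `dim R`. -/
structure IsRegularAlgebra [IsRegularLocalRing R] : Prop where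
  finite : Module.Finite R L
  injective : Function.Injective (algebraMap R L)
  center_eq : Set.range (algebraMap R L) = Set.center L
  free : Module.Free R L
  globalDimension_eq : globalDimension L = ringKrullDim R

/-- The ideal `⟨P⟩` of the category of `L`-modules, at `(X, Y)`: the subgroup of `Hom_L(X, Y)`
generated by the maps that factor through `P`, i.e. the maps that factor through some `Pⁿ`. -/
def throughIdeal {L : Type u} [Ring L] (P X Y : Type u) [AddCommGroup P] [Module L P]
    [AddCommGroup X] [Module L X] [AddCommGroup Y] [Module L Y] : AddSubgroup (X →ₗ[L] Y) :=
  AddSubgroup.closure {h | ∃ (a : X →ₗ[L] P) (b : P →ₗ[L] Y), h = b ∘ₗ a}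

section

variable {L : Type u} [Ring L] {P X Y Z : Type u} [AddCommGroup P] [Module L P]
  [AddCommGroup X] [Module L X] [AddCommGroup Y] [Module L Y] [AddCommGroup Z] [Module L Z]

lemma comp_mem_throughIdeal (b : P →ₗ[L] Y) (a : X →ₗ[L] P) : b ∘ₗ a ∈ throughIdeal P X Y :=
  AddSubgroup.subset_closure ⟨a, b, rfl⟩

lemma throughIdeal_precomp (k : X →ₗ[L] Y) {h : Y →ₗ[L] Z} (hh : h ∈ throughIdeal P Y Z) :
    h ∘ₗ k ∈ throughIdeal P X Z := by
  induction hh using AddSubgroup.closure_induction with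
  | mem x hx =>
    obtain ⟨a, b, rfl⟩ := hx
    exact comp_mem_throughIdeal b (a ∘ₗ k)
  | zero => simp
  | add x y _ _ hx hy => simpa [LinearMap.add_comp] using add_mem hx hy
  | neg x _ hx => simpa [LinearMap.neg_comp] using neg_mem hx

lemma throughIdeal_postcomp (k : Y →ₗ[L] Z) {h : X →ₗ[L] Y} (hh : h ∈ throughIdeal P X Y) :
    k ∘ₗ h ∈ throughIdeal P X Z := by
  induction hh using AddSubgroup.closure_induction with
  | mem x hx =>
    obtain ⟨a, b, rfl⟩ := hx
    exact comp_mem_throughIdeal (k ∘ₗ b) a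
  | zero => simp
  | add x y _ _ hx hy => simpa [LinearMap.comp_add] using add_mem hx hy
  | neg x _ hx => simpa [LinearMap.comp_neg] using neg_mem hx

end

/-- Two maps of maximal Cohen-Macaulay modules are identified modulo `⟨P⟩`. -/
def throughRel (P : Type u) [AddCommGroup P] [Module L P] : HomRel (MCM R L) :=
  fun M N g h => g.hom.hom - h.hom.hom ∈ throughIdeal P M.obj N.obj

/-- The quotient category `(MCM L) / ⟨P⟩`. -/
abbrev StableMCM (P : Type u) [AddCommGroup P] [Module L P] :=
  CategoryTheory.Quotient (throughRel R L P)

end General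

/-! ### The double cover, the skew group ring and the hypersurface quotient -/

variable (R : Type u) [CommRing R] (B : Type u) [Ring B] [Algebra R B] (f : R)

/-- `A = B / (f)`. -/
abbrev HypersurfaceQuotient := B ⧸ Ideal.span {algebraMap R B f}

instance : (Ideal.span {algebraMap R B f}).IsTwoSided :=
  ⟨fun {a} b ha => by
    rw [Ideal.mem_span_singleton'] at ha ⊢
    obtain ⟨c, rfl⟩ := ha
    exact ⟨c * b, by rw [mul_assoc, mul_assoc, Algebra.commutes]⟩⟩

/-- `A = B / (f)` as an algebra over `R / (f)`. -/
instance instAlgebraHypersurfaceQuotient :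
    Algebra (R ⧸ Ideal.span {f}) (HypersurfaceQuotient R B f) :=
  RingHom.toAlgebra'
    (Ideal.quotientMap (I := Ideal.span {f}) (Ideal.span {algebraMap R B f}) (algebraMap R B)
      (by
        rw [Ideal.span_le, Set.singleton_subset_iff]
        exact Ideal.subset_span rfl))
    (by
      intro c x
      obtain ⟨c, rfl⟩ := Ideal.Quotient.mk_surjective c
      obtain ⟨x, rfl⟩ := Ideal.Quotient.mk_surjective x
      rw [Ideal.quotientMap_mk, ← map_mul, ← map_mul, Algebra.commutes])

/-- `R[√f] = R[z] / (z² - f)`, with `z = QuadraticAlgebra.omega`. -/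
abbrev SqrtBase := QuadraticAlgebra R f 0

/-- `B[√f] = R[√f] ⊗_R B = B[z] / (z² - f)`. -/
abbrev DoubleCover := SqrtBase R f ⊗[R] B

/-- The `R`-algebra endomorphism `z ↦ -z` of `R[√f]`. -/
def sigmaBase : SqrtBase R f →ₐ[R] SqrtBase R f :=
  QuadraticAlgebra.lift ⟨-QuadraticAlgebra.omega, by
    rw [neg_mul_neg, zero_smul, add_zero, QuadraticAlgebra.omega_mul_omega_eq_add,
      zero_smul, add_zero]⟩

/-- The automorphism `σ` of `B[√f]`: it sends `z` to `-z` and fixes `B`. -/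
def sigma : DoubleCover R B f →ₐ[R] DoubleCover R B f :=
  Algebra.TensorProduct.map (sigmaBase R f) (AlgHom.id R B)

lemma sigmaBase_sigmaBase (x : SqrtBase R f) : sigmaBase R f (sigmaBase R f x) = x := by
  have : (sigmaBase R f).comp (sigmaBase R f) = AlgHom.id R _ := by
    ext <;> simp [sigmaBase]
  exact DFunLike.congr_fun this x

lemma sigma_sigma (x : DoubleCover R B f) : sigma R B f (sigma R B f x) = x := by
  induction x using TensorProduct.induction_on with
  | zero => simp
  | tmul a b => simp [sigma, sigmaBase_sigmaBase]
  | add x y hx hy => rw [map_add, map_add, hx, hy]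

/-- The cyclic group `G_f` of order two, written multiplicatively. -/
abbrev Gf := Multiplicative (ZMod 2)

/-- The generator of `G_f`. -/
def genGf : Gf := Multiplicative.ofAdd 1

/-- The generator of `G_f` acts on `B[√f]` by `σ`. -/
instance instActionGf : MulSemiringAction Gf (DoubleCover R B f) where
  smul g x := if g = 1 then x else sigma R B f x
  one_smul x := if_pos rfl
  mul_smul g h x := by
    change (if g * h = 1 then x else sigma R B f x) =
      if g = 1 then (if h = 1 then x else sigma R B f x)
        else sigma R B f (if h = 1 then x else sigma R B f x)
    have key : ∀ g h : Gf, g ≠ 1 → h ≠ 1 → g * h = 1 := by decide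
    by_cases hg : g = 1
    · subst hg; simp
    · by_cases hh : h = 1
      · subst hh; simp [hg]
      · simp [hg, hh, key g h hg hh, sigma_sigma]
  smul_zero g := by
    change (if g = 1 then 0 else sigma R B f 0) = 0
    simp
  smul_add g x y := by
    change (if g = 1 then x + y else sigma R B f (x + y)) =
      (if g = 1 then x else sigma R B f x) + (if g = 1 then y else sigma R B f y)
    split_ifs <;> simp
  smul_one g := by
    change (if g = 1 then 1 else sigma R B f 1) = 1
    simp
  smul_mul g x y := by
    change (if g = 1 then x * y else sigma R B f (x * y)) =
      (if g = 1 then x else sigma R B f x) * (if g = 1 then y else sigma R B f y)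
    split_ifs <;> simp

lemma genGf_smul (x : DoubleCover R B f) : genGf • x = sigma R B f x :=
  if_neg (by decide : genGf ≠ 1)

instance : SMulCommClass Gf R (DoubleCover R B f) where
  smul_comm g r x := by
    change (if g = 1 then r • x else sigma R B f (r • x)) =
      r • (if g = 1 then x else sigma R B f x)
    split_ifs <;> simp

/-- The skew group ring `Λ = B[√f] * G_f`. -/
def Lam := SkewMonoidAlgebra (DoubleCover R B f) Gf

instance instRingLam : Ring (Lam R B f) :=
  inferInstanceAs (Ring (SkewMonoidAlgebra (DoubleCover R B f) Gf))

instance instAlgebraLam : Algebra R (Lam R B f) :=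
  inferInstanceAs (Algebra R (SkewMonoidAlgebra (DoubleCover R B f) Gf))

/-- The element `x g` of `Λ`, for `x ∈ B[√f]` and `g ∈ G_f`. -/
def single (g : Gf) (x : DoubleCover R B f) : Lam R B f := SkewMonoidAlgebra.single g x

/-- The multiplication rule `(x g) (y h) = x g(y) gh` of `Λ`. -/
lemma single_mul_single (g h : Gf) (x y : DoubleCover R B f) :
    single R B f g x * single R B f h y = single R B f (g * h) (x * g • y) :=
  SkewMonoidAlgebra.single_mul_single

lemma single_neg (g : Gf) (x : DoubleCover R B f) : single R B f g (-x) = -single R B f g x := by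
  rw [eq_neg_iff_add_eq_zero]
  refine (SkewMonoidAlgebra.single_add g (-x) x).symm.trans ?_
  rw [neg_add_cancel]
  exact SkewMonoidAlgebra.single_zero g

/-- The inclusion `B → B[√f] → Λ`. -/
def inclB : B →+* Lam R B f :=
  (SkewMonoidAlgebra.singleOneRingHom (k := DoubleCover R B f) (G := Gf)).comp
    (Algebra.TensorProduct.includeRight : B →ₐ[R] DoubleCover R B f).toRingHom

/-- The element `z` of `Λ`. -/
def zLam : Lam R B f := single R B f 1 (QuadraticAlgebra.omega ⊗ₜ[R] 1)

/-- The element `σ` of `Λ`. -/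
def sigmaLam : Lam R B f := single R B f genGf 1

/-- `ε = ½ (1 - σ)`; here `2` is a unit of `R`, and `Ring.inverse` is its inverse. -/
def eps : Lam R B f := (Ring.inverse (2 : R)) • (1 - sigmaLam R B f)

/-- The left `Λ`-module `Λε`. -/
abbrev LamEps : Submodule (Lam R B f) (Lam R B f) := Submodule.span _ {eps R B f}

/-- The left `Λ`-module `Λ(1-ε)`, which is `B[√f]` with its natural `Λ`-action. -/
abbrev LamOneSubEps : Submodule (Lam R B f) (Lam R B f) := Submodule.span _ {1 - eps R B f}

/-- The stable category of maximal Cohen-Macaulay `Λ`-modules, `(MCM Λ) / ⟨B[√f]⟩`. -/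
abbrev StableMCMLam := StableMCM R (Lam R B f) (LamOneSubEps R B f)

/-! ### The functor `Hom(Λε, -)` modulo `⟨B[√f]⟩`, with values in `A`-modules -/

lemma inclB_apply (b : B) : inclB R B f b = single R B f 1 (1 ⊗ₜ[R] b) := rfl

lemma sigmaLam_mul_inclB (b : B) :
    sigmaLam R B f * inclB R B f b = inclB R B f b * sigmaLam R B f := by
  rw [inclB_apply, sigmaLam, single_mul_single, single_mul_single, genGf_smul]
  simp [sigma]

lemma sigmaLam_mul_zLam : sigmaLam R B f * zLam R B f = -(zLam R B f * sigmaLam R B f) := by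
  rw [sigmaLam, zLam, single_mul_single, single_mul_single, genGf_smul, mul_one, one_mul,
    ← single_neg]
  simp [sigma, sigmaBase, TensorProduct.neg_tmul]

lemma zLam_mul_zLam : zLam R B f * zLam R B f = inclB R B f (algebraMap R B f) := by
  rw [inclB_apply, zLam, single_mul_single, one_smul, Algebra.TensorProduct.tmul_mul_tmul,
    QuadraticAlgebra.omega_mul_omega_eq_add, zero_smul, add_zero, mul_one, one_mul,
    TensorProduct.smul_tmul, Algebra.algebraMap_eq_smul_one]

lemma eps_mul_inclB (b : B) : eps R B f * inclB R B f b = inclB R B f b * eps R B f := by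
  rw [eps, smul_mul_assoc, mul_smul_comm, sub_mul, mul_sub, sigmaLam_mul_inclB, one_mul, mul_one]

lemma eps_mul_zLam (h : IsUnit (2 : R)) :
    eps R B f * zLam R B f = zLam R B f * (1 - eps R B f) := by
  have h2 : Ring.inverse (2 : R) * 2 = 1 := Ring.inverse_mul_cancel _ h
  have key : zLam R B f = Ring.inverse (2 : R) • (zLam R B f + zLam R B f) := by
    rw [← two_smul R (zLam R B f), smul_smul, h2, one_smul]
  rw [eps, mul_sub, smul_mul_assoc, mul_smul_comm, sub_mul, mul_sub, sigmaLam_mul_zLam, one_mul,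
    mul_one]
  nth_rewrite 3 [key]
  rw [← smul_sub]
  congr 1
  abel

/-- Right multiplication by `b ∈ B` on `Λε`; it is well defined as `b` commutes with `ε`. -/
def rightMul (b : B) : LamEps R B f →ₗ[Lam R B f] LamEps R B f where
  toFun x := ⟨x.1 * inclB R B f b, by
    obtain ⟨c, hc⟩ := Submodule.mem_span_singleton.1 x.2
    refine Submodule.mem_span_singleton.2 ⟨c * inclB R B f b, ?_⟩
    rw [← hc, smul_eq_mul, smul_eq_mul, mul_assoc, mul_assoc, eps_mul_inclB]⟩
  map_add' x y := Subtype.ext (add_mul _ _ _)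
  map_smul' c x := Subtype.ext (mul_assoc _ _ _)

lemma rightMul_one : rightMul R B f 1 = LinearMap.id := by
  ext x
  change x.1 * inclB R B f 1 = x.1
  rw [map_one, mul_one]

lemma rightMul_mul (b c : B) :
    rightMul R B f (b * c) = rightMul R B f c ∘ₗ rightMul R B f b := by
  ext x
  change x.1 * inclB R B f (b * c) = x.1 * inclB R B f b * inclB R B f c
  rw [map_mul, mul_assoc]

lemma rightMul_zero : rightMul R B f 0 = 0 := by
  ext x
  change x.1 * inclB R B f 0 = 0
  rw [map_zero, mul_zero]

lemma rightMul_add (b c : B) :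
    rightMul R B f (b + c) = rightMul R B f b + rightMul R B f c := by
  ext x
  change x.1 * inclB R B f (b + c) = x.1 * inclB R B f b + x.1 * inclB R B f c
  rw [map_add, mul_add]

/-- Right multiplication by the multiple `b f` of `f` on `Λε` factors through `Λ(1-ε)`. -/
lemma rightMul_mem (b : B) :
    rightMul R B f (b * algebraMap R B f) ∈
      throughIdeal (LamOneSubEps R B f) (LamEps R B f) (LamEps R B f) := by
  by_cases h : IsUnit (2 : R)
  · have hz := eps_mul_zLam R B f h
    have hz' : (1 - eps R B f) * zLam R B f = zLam R B f * eps R B f := by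
      rw [sub_mul, hz, mul_sub, one_mul, mul_one, sub_sub_cancel]
    let a : LamEps R B f →ₗ[Lam R B f] LamOneSubEps R B f :=
      { toFun := fun x => ⟨x.1 * zLam R B f, by
          obtain ⟨c, hc⟩ := Submodule.mem_span_singleton.1 x.2
          refine Submodule.mem_span_singleton.2 ⟨c * zLam R B f, ?_⟩
          rw [← hc, smul_eq_mul, smul_eq_mul, mul_assoc, mul_assoc, hz]⟩
        map_add' := fun x y => Subtype.ext (add_mul _ _ _)
        map_smul' := fun c x => Subtype.ext (mul_assoc _ _ _) }
    let d : LamOneSubEps R B f →ₗ[Lam R B f] LamEps R B f :=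
      { toFun := fun x => ⟨x.1 * zLam R B f, by
          obtain ⟨c, hc⟩ := Submodule.mem_span_singleton.1 x.2
          refine Submodule.mem_span_singleton.2 ⟨c * zLam R B f, ?_⟩
          rw [← hc, smul_eq_mul, smul_eq_mul, mul_assoc, mul_assoc, hz']⟩
        map_add' := fun x y => Subtype.ext (add_mul _ _ _)
        map_smul' := fun c x => Subtype.ext (mul_assoc _ _ _) }
    have : rightMul R B f (b * algebraMap R B f) = d ∘ₗ (a ∘ₗ rightMul R B f b) := by
      ext x
      change x.1 * inclB R B f (b * algebraMap R B f) =
        x.1 * inclB R B f b * zLam R B f * zLam R B f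
      rw [map_mul, mul_assoc _ (zLam R B f), zLam_mul_zLam, mul_assoc]
    rw [this]
    exact comp_mem_throughIdeal _ _
  · have h0 : eps R B f = 0 := by rw [eps, Ring.inverse_non_unit _ h, zero_smul]
    have : rightMul R B f (b * algebraMap R B f) = 0 := by
      ext x
      obtain ⟨c, hc⟩ := Submodule.mem_span_singleton.1 x.2
      change x.1 * inclB R B f (b * algebraMap R B f) = 0
      rw [← hc, h0, smul_zero, zero_mul]
    rw [this]
    exact zero_mem _

section StableHom

variable (M : Type u) [AddCommGroup M] [Module (Lam R B f) M]

/-- The homomorphism group from `Λε` to `M` modulo `⟨B[√f]⟩`. -/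
abbrev StableHom :=
  (LamEps R B f →ₗ[Lam R B f] M) ⧸ throughIdeal (LamOneSubEps R B f) (LamEps R B f) M

/-- The class of `b ∈ B` acts on the class of `φ` as `φ ∘ (right multiplication by b)`. -/
def stableHomActionB : B →+* AddMonoid.End (StableHom R B f M) where
  toFun b := QuotientAddGroup.map _ _
    { toFun := fun φ => φ ∘ₗ rightMul R B f b
      map_zero' := LinearMap.zero_comp _
      map_add' := fun φ ψ => LinearMap.add_comp _ _ _ }
    (fun _ hφ => throughIdeal_precomp _ hφ)
  map_one' := by
    ext φ
    induction φ using QuotientAddGroup.induction_on with | H φ => ?_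
    change QuotientAddGroup.mk (φ ∘ₗ rightMul R B f 1) = QuotientAddGroup.mk φ
    rw [rightMul_one, LinearMap.comp_id]
  map_mul' b c := by
    ext φ
    induction φ using QuotientAddGroup.induction_on with | H φ => ?_
    change QuotientAddGroup.mk (φ ∘ₗ rightMul R B f (b * c)) =
      QuotientAddGroup.mk ((φ ∘ₗ rightMul R B f c) ∘ₗ rightMul R B f b)
    rw [rightMul_mul, LinearMap.comp_assoc]
  map_zero' := by
    ext φ
    induction φ using QuotientAddGroup.induction_on with | H φ => ?_
    change QuotientAddGroup.mk (φ ∘ₗ rightMul R B f 0) = QuotientAddGroup.mk 0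
    rw [rightMul_zero, LinearMap.comp_zero]
  map_add' b c := by
    ext φ
    induction φ using QuotientAddGroup.induction_on with | H φ => ?_
    change QuotientAddGroup.mk (φ ∘ₗ rightMul R B f (b + c)) =
      QuotientAddGroup.mk (φ ∘ₗ rightMul R B f b + φ ∘ₗ rightMul R B f c)
    rw [rightMul_add, LinearMap.comp_add]

/-- The action of `A = B / (f)`. -/
def stableHomAction : HypersurfaceQuotient R B f →+* AddMonoid.End (StableHom R B f M) :=
  Ideal.Quotient.lift _ (stableHomActionB R B f M) (by
    intro a ha
    obtain ⟨b, rfl⟩ := Ideal.mem_span_singleton'.1 ha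
    ext φ
    induction φ using QuotientAddGroup.induction_on with | H φ => ?_
    exact (QuotientAddGroup.eq_zero_iff _).2 (throughIdeal_postcomp φ (rightMul_mem R B f b)))

instance instModuleStableHom : Module (HypersurfaceQuotient R B f) (StableHom R B f M) :=
  Module.compHom _ (stableHomAction R B f M)

variable {M} in
lemma mk_smul_mk (b : B) (φ : LamEps R B f →ₗ[Lam R B f] M) :
    (Ideal.Quotient.mk _ b : HypersurfaceQuotient R B f) • (QuotientAddGroup.mk φ :
      StableHom R B f M) = QuotientAddGroup.mk (φ ∘ₗ rightMul R B f b) := rfl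

variable {M} in
/-- Functoriality of the stable homomorphism group: composition with `g`. -/
def stableHomMap {N : Type u} [AddCommGroup N] [Module (Lam R B f) N] (g : M →ₗ[Lam R B f] N) :
    StableHom R B f M →ₗ[HypersurfaceQuotient R B f] StableHom R B f N where
  __ := QuotientAddGroup.map (throughIdeal (LamOneSubEps R B f) (LamEps R B f) M)
      (throughIdeal (LamOneSubEps R B f) (LamEps R B f) N)
    { toFun := fun φ : LamEps R B f →ₗ[Lam R B f] M => g ∘ₗ φ
      map_zero' := LinearMap.comp_zero _
      map_add' := fun φ ψ => LinearMap.comp_add _ _ _ }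
    (fun _ hφ => throughIdeal_postcomp g hφ)
  map_smul' a φ := by
    obtain ⟨b, rfl⟩ := Ideal.Quotient.mk_surjective a
    induction φ using QuotientAddGroup.induction_on
    rfl

end StableHom

/-- `M ↦ Hom(Λε, M)` modulo `⟨B[√f]⟩`, from maximal Cohen-Macaulay `Λ`-modules to `A`-modules. -/
def stableHomFunctorMCM : MCM R (Lam R B f) ⥤ ModuleCat.{u} (HypersurfaceQuotient R B f) where
  obj M := ModuleCat.of _ (StableHom R B f M.obj)
  map g := ModuleCat.ofHom (stableHomMap R B f g.hom.hom)
  map_id M := by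
    ext φ
    induction φ using QuotientAddGroup.induction_on
    rfl
  map_comp g h := by
    ext φ
    induction φ using QuotientAddGroup.induction_on
    rfl

/-- The functor `Hom(Λε, -)` of the stable category of maximal Cohen-Macaulay `Λ`-modules,
with values in `A`-modules. -/
def stableHomFunctor : StableMCMLam R B f ⥤ ModuleCat.{u} (HypersurfaceQuotient R B f) :=
  CategoryTheory.Quotient.lift _ (stableHomFunctorMCM R B f) (by
    intro M N g h hgh
    ext φ
    induction φ using QuotientAddGroup.induction_on with | H φ => ?_
    refine (QuotientAddGroup.eq_iff_sub_mem).2 ?_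
    change g.hom.hom ∘ₗ φ - h.hom.hom ∘ₗ φ ∈ _
    rw [← LinearMap.sub_comp]
    exact throughIdeal_precomp φ hgh)

end Knoerrer

end

/-! A module `M` over `Λ` is the direct sum of its even part `M₀` (`σ = 1`) and its odd part `M₁`
(`σ = -1`), on which `B` acts, together with the maps `z : M₀ → M₁` and `z : M₁ → M₀`, whose
composites are multiplication by `f`. The theorem rests on two facts.

* `M` is maximal Cohen-Macaulay if and only if `M₀` and `M₁` are finite projective over `B`
  (`IsRegularAlgebra.isMCM_lam_iff`), that is, if `M` is a matrix factorization of `f` over `B`.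
  The essential input is one half of the Auslander-Buchsbaum formula over the noncommutative
  ring `B` (`hasProjectiveDimensionLT_of_isWeaklyRegular`): a finite module with a regular
  sequence of length `l` has projective dimension at most `gl.dim B - l`.
* Homomorphisms from `Λε` to `M` are the odd elements of `M`, and those that factor through copies
  of `Λ(1-ε)` are the elements of `z M₀`, so that the functor is `M ↦ M₁ / z M₀`
  (`stableHomEquiv`).

As `z : M₀ → M₁` is injective, the depth lemma shows that `M₁ / z M₀` is maximal Cohen-Macaulay
over `A`. The functor is full since maps of cokernels lift to projective presentations. It is
faithful since a map that vanishes on the cokernel is null-homotopic by a map from the odd to the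
even part, and the target of this homotopy is a summand of a free module, which makes the map
factor through copies of `Λ(1-ε)`. It is dense since a maximal Cohen-Macaulay `A`-module has
projective dimension at most one over `B`, and its presentation by projective modules is half of
a matrix factorization.

As `R` is complete, an indecomposable maximal Cohen-Macaulay `Λ`-module has a local endomorphism
ring (`IsRegularAlgebra.localEnd_lam`). Hence the functor gives an injection from the isomorphism
classes of those that it does not annihilate to the classes of indecomposable maximal
Cohen-Macaulay `A`-modules, and this injection is surjective by
`IsRegularAlgebra.exists_indecomposable`. The indecomposable modules that the functor annihilates
are summands of the Noetherian module `Λ(1-ε)`, and a Noetherian module has only finitely many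
summands with local endomorphism ring (`finite_summandClasses`). -/

noncomputable section

namespace Knoerrer

/-! ### Regular local rings and depth -/

section RegularLocal

open IsLocalRing RingTheory.Sequence
open scoped Pointwise

/-- An element outside `𝔪²` belongs to a system of generators of `𝔪` of minimal length: lift
a basis of the cotangent space that contains its class. -/
lemma exists_span_maximalIdeal_containing {R : Type*} [CommRing R] [IsLocalRing R]
    [IsNoetherianRing R] {x : R} (hx : x ∈ maximalIdeal R) (hx2 : x ∉ maximalIdeal R ^ 2) :
    ∃ s : Set R, s.Finite ∧ s.ncard + 1 ≤ (maximalIdeal R).spanFinrank ∧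
      Ideal.span (insert x s) = maximalIdeal R := by
  classical
  set v : CotangentSpace R := (maximalIdeal R).toCotangent ⟨x, hx⟩ with hv
  have hv0 : v ≠ 0 := fun h => hx2 (((maximalIdeal R).toCotangent_eq_zero _).1 h)
  have hli : LinearIndepOn (ResidueField R) id ({v} : Set (CotangentSpace R)) :=
    LinearIndepOn.singleton hv0
  let b := Module.Basis.extend hli
  set t : Set (CotangentSpace R) := hli.extend (Set.subset_univ _) with ht
  have hvt : v ∈ t := hli.subset_extend _ rfl
  have : Finite t := Module.Finite.finite_basis b
  have htc : t.ncard = (maximalIdeal R).spanFinrank := by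
    rw [spanFinrank_maximalIdeal_eq_finrank_cotangentSpace, Module.finrank_eq_nat_card_basis b,
      Nat.card_coe_set_eq]
  choose g hg using fun w : CotangentSpace R => (maximalIdeal R).toCotangent_surjective w
  let y : CotangentSpace R → R := fun w => (g w : R)
  refine ⟨y '' (t \ {v}), (t.toFinite.sdiff).image _, ?_, ?_⟩
  · have h1 := Set.ncard_image_le (f := y) (t.toFinite.sdiff (t := {v}))
    have h2 := Set.ncard_sdiff_singleton_add_one hvt t.toFinite
    omega
  · have : Submodule.span R (insert (⟨x, hx⟩ : maximalIdeal R) (g '' (t \ {v}))) = ⊤ := by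
      rw [← CotangentSpace.span_image_eq_top_iff, Set.image_insert_eq, ← Set.image_comp]
      have : ((maximalIdeal R).toCotangent ∘ g) = id := funext hg
      rw [this, Set.image_id, ← hv, Set.insert_sdiff_singleton, Set.insert_eq_of_mem hvt]
      exact (hli.span_extend_eq_span _).trans Submodule.span_univ
    have h2 := congrArg (Submodule.map (maximalIdeal R).subtype) this
    rw [Submodule.map_span, Submodule.map_top, Submodule.range_subtype, Set.image_insert_eq,
      ← Set.image_comp] at h2
    exact h2

/-- Cutting a regular local ring by a parameter outside `𝔪²` gives a regular local ring. -/
lemma isRegularLocalRing_quotient {R : Type*} [CommRing R] [IsRegularLocalRing R] {x : R}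
    (hx : x ∈ maximalIdeal R) (hx2 : x ∉ maximalIdeal R ^ 2) :
    IsRegularLocalRing (R ⧸ Ideal.span {x}) ∧
      ringKrullDim (R ⧸ Ideal.span {x}) + 1 = ringKrullDim R := by
  have hne : Ideal.span {x} ≠ (⊤ : Ideal R) := fun h =>
    (maximalIdeal.isMaximal R).ne_top (top_le_iff.1 (h ▸ (Ideal.span_singleton_le_iff_mem _).2 hx))
  have : Nontrivial (R ⧸ Ideal.span {x}) := Ideal.Quotient.nontrivial_iff.2 hne
  have hloc : IsLocalRing (R ⧸ Ideal.span {x}) :=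
    IsLocalRing.of_surjective' (Ideal.Quotient.mk _) Ideal.Quotient.mk_surjective
  obtain ⟨s, hs, hsc, hspan⟩ := exists_span_maximalIdeal_containing hx hx2
  have hmap : maximalIdeal (R ⧸ Ideal.span {x}) =
      Ideal.span (Ideal.Quotient.mk (Ideal.span {x}) '' s) := by
    rw [← IsLocalRing.map_maximalIdeal_of_surjective (Ideal.Quotient.mk (Ideal.span {x}))
      Ideal.Quotient.mk_surjective, ← hspan, Ideal.map_span, Set.image_insert_eq,
      Ideal.Quotient.eq_zero_iff_mem.2 (Ideal.mem_span_singleton_self x), Ideal.span_insert_zero]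
  have hle : (maximalIdeal (R ⧸ Ideal.span {x})).spanFinrank + 1 ≤
      (maximalIdeal R).spanFinrank := by
    rw [hmap]
    have h1 := Submodule.spanFinrank_span_le_ncard_of_finite (R := R ⧸ Ideal.span {x})
      (hs.image (Ideal.Quotient.mk (Ideal.span {x})))
    have h2 := Set.ncard_image_le (f := Ideal.Quotient.mk (Ideal.span {x})) hs
    have := h1.trans h2
    exact (Nat.add_le_add_right this 1).trans hsc
  have hR := IsRegularLocalRing.spanFinrank_maximalIdeal (R := R)
  have hdim : ringKrullDim R ≤ ringKrullDim (R ⧸ Ideal.span {x}) + 1 := by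
    have := ringKrullDim_le_ringKrullDim_quotient_add_card ({x} : Finset R)
      (by simpa [IsLocalRing.ringJacobson_eq_maximalIdeal] using hx)
    rwa [Finset.card_singleton, Finset.coe_singleton, Nat.cast_one] at this
  have hup := ringKrullDim_le_spanFinrank_maximalIdeal (R ⧸ Ideal.span {x})
  rw [← hR] at hdim ⊢
  have hfin : ((maximalIdeal (R ⧸ Ideal.span {x})).spanFinrank : WithBot ℕ∞) + 1 ≤
      (maximalIdeal R).spanFinrank := by exact_mod_cast hle
  have hup1 : ringKrullDim (R ⧸ Ideal.span {x}) + 1 ≤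
      ((maximalIdeal (R ⧸ Ideal.span {x})).spanFinrank : WithBot ℕ∞) + 1 := by gcongr
  refine ⟨IsRegularLocalRing.of_spanFinrank_maximalIdeal_le _ ?_,
    le_antisymm (hup1.trans hfin) hdim⟩
  exact ENat.WithBot.add_le_add_one_right_iff.1 (hfin.trans hdim)

/-- A finite family of primes different from the maximal ideal, together with `𝔪²`, does not cover
the maximal ideal of a regular local ring of positive dimension. -/
lemma exists_mem_maximalIdeal_notMem_sq {R : Type*} [CommRing R] [IsRegularLocalRing R]
    (hd : ringKrullDim R ≠ 0) {S : Set (Ideal R)} (hS : S.Finite)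
    (hp : ∀ p ∈ S, p.IsPrime ∧ p ≠ maximalIdeal R) :
    ∃ x ∈ maximalIdeal R, x ∉ maximalIdeal R ^ 2 ∧ ∀ p ∈ S, x ∉ p := by
  have hne : maximalIdeal R ≠ maximalIdeal R ^ 2 := by
    intro h
    have h0 : maximalIdeal R = ⊥ := by
      refine Submodule.eq_bot_of_le_smul_of_le_jacobson_bot (maximalIdeal R) (maximalIdeal R)
        (IsNoetherian.noetherian _) ?_ (IsLocalRing.maximalIdeal_le_jacobson _)
      rw [smul_eq_mul, ← pow_two, ← h]
    apply hd
    rw [← IsRegularLocalRing.spanFinrank_maximalIdeal, h0]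
    simp
  by_contra! hcon
  have := (Ideal.subset_iUnion_iff_mem_of_isMaximal_of_finite (M := maximalIdeal R)
    (hS.insert (maximalIdeal R ^ 2)) (maximalIdeal R ^ 2) (maximalIdeal R ^ 2)
    (by
      rintro I (rfl | hI) h1 -
      · exact absurd rfl h1
      · exact (hp I hI).1)
    (fun h => (maximalIdeal.isMaximal R).ne_top
      (top_le_iff.1 (h ▸ Ideal.pow_le_self two_ne_zero)))
    (fun h => (maximalIdeal.isMaximal R).ne_top
      (top_le_iff.1 (h ▸ Ideal.pow_le_self two_ne_zero)))).1
    (by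
      intro x hx
      by_cases hx2 : x ∈ maximalIdeal R ^ 2
      · exact Set.mem_biUnion (Set.mem_insert _ _) hx2
      · obtain ⟨p, hpS, hxp⟩ := hcon x hx hx2
        exact Set.mem_biUnion (Set.mem_insert_of_mem _ hpS) hxp)
  rcases this with h | h
  · exact hne h
  · exact (hp _ h).2 rfl

lemma exists_natCast_eq_ringKrullDim (R : Type*) [CommRing R] [IsRegularLocalRing R] :
    ∃ n : ℕ, ringKrullDim R = n :=
  ⟨_, IsRegularLocalRing.spanFinrank_maximalIdeal.symm⟩

/-- By induction on the dimension: some `x ∈ 𝔪 ∖ 𝔪²` avoids all minimal primes, and `(x)` is prime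
as `R / (x)` is regular; a minimal prime `p ⊆ (x)` satisfies `p = xp`, hence `p = 0`. -/
lemma isDomain_of_isRegularLocalRing (R : Type*) [CommRing R] [IsRegularLocalRing R] :
    IsDomain R := by
  obtain ⟨n, hn⟩ := exists_natCast_eq_ringKrullDim R
  induction n generalizing R with
  | zero =>
    have h0 : maximalIdeal R = ⊥ := by
      have := IsRegularLocalRing.spanFinrank_maximalIdeal (R := R)
      rw [hn] at this
      rw [← Submodule.spanFinrank_eq_zero_iff_eq_bot (IsNoetherian.noetherian _)]
      exact_mod_cast this
    exact (IsLocalRing.isField_iff_maximalIdeal_eq.2 h0).isDomain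
  | succ n ih =>
    have hd : ringKrullDim R ≠ 0 := by rw [hn]; exact_mod_cast n.succ_ne_zero
    obtain ⟨x, hx, hx2, hxp⟩ := exists_mem_maximalIdeal_notMem_sq hd
      (minimalPrimes.finite_of_isNoetherianRing R) (fun p hp => by
        refine ⟨hp.1.1, ?_⟩
        rintro rfl
        apply hd
        rw [← IsLocalRing.maximalIdeal_height_eq_ringKrullDim,
          Ideal.height_eq_zero_iff.2 hp]
        rfl)
    obtain ⟨hreg, hdim⟩ := isRegularLocalRing_quotient hx hx2
    have hdom : IsDomain (R ⧸ Ideal.span {x}) := by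
      refine ih _ ?_
      rw [hn, Nat.cast_succ] at hdim
      exact (ENat.WithBot.add_one_cancel).1 hdim
    have hprime : (Ideal.span {x}).IsPrime := (Ideal.Quotient.isDomain_iff_prime _).1 hdom
    obtain ⟨p, hpmin, hple⟩ := Ideal.exists_minimalPrimes_le (bot_le : ⊥ ≤ Ideal.span {x})
    have hpp : p.IsPrime := hpmin.1.1
    have hbot : p = ⊥ := by
      refine Submodule.eq_bot_of_le_smul_of_le_jacobson_bot (maximalIdeal R) p
        (IsNoetherian.noetherian _) ?_ (IsLocalRing.maximalIdeal_le_jacobson _)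
      intro y hy
      obtain ⟨c, rfl⟩ := Ideal.mem_span_singleton'.1 (hple hy)
      rw [mul_comm]
      exact Submodule.smul_mem_smul hx ((hpp.mem_or_mem hy).resolve_right (hxp p hpmin))
    rw [hbot] at hpp
    exact IsDomain.of_bot_isPrime R

lemma exists_isWeaklyRegular_self (R : Type*) [CommRing R] [IsRegularLocalRing R]
    {n : ℕ} (hn : ringKrullDim R = n) :
    ∃ rs : List R, rs.length = n ∧ (∀ r ∈ rs, r ∈ maximalIdeal R) ∧ IsWeaklyRegular R rs := by
  induction n generalizing R with
  | zero => exact ⟨[], rfl, by simp, IsWeaklyRegular.nil R R⟩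
  | succ n ih =>
    have hd : ringKrullDim R ≠ 0 := by rw [hn]; exact_mod_cast n.succ_ne_zero
    obtain ⟨x, hx, hx2, -⟩ := exists_mem_maximalIdeal_notMem_sq (R := R) hd Set.finite_empty
      (by simp)
    obtain ⟨hreg, hdim⟩ := isRegularLocalRing_quotient hx hx2
    rw [hn, Nat.cast_succ] at hdim
    obtain ⟨rs, hlen, hmem, hrs⟩ := ih (R ⧸ Ideal.span {x}) (ENat.WithBot.add_one_cancel.1 hdim)
    have hdom := isDomain_of_isRegularLocalRing R
    obtain ⟨ss, rfl⟩ : ∃ ss : List R, ss.map (Ideal.Quotient.mk (Ideal.span {x})) = rs :=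
      List.map_surjective_iff.2 Ideal.Quotient.mk_surjective rs
    refine ⟨x :: ss, by simpa using hlen, ?_, ?_⟩
    · intro r hr
      rcases List.mem_cons.1 hr with rfl | hr
      · exact hx
      · have := hmem _ (List.mem_map_of_mem hr)
        rw [mem_maximalIdeal, mem_nonunits_iff] at this ⊢
        exact fun h => this (h.map _)
    · have hx0 : x ≠ 0 := fun h => hx2 (h ▸ zero_mem _)
      refine IsWeaklyRegular.cons ?_ ?_
      · exact fun a b hab => mul_left_cancel₀ hx0 hab
      · have h : Ideal.span {x} = x • (⊤ : Submodule R R) := by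
          rw [← Submodule.ideal_span_singleton_smul]; simp
        have e : (R ⧸ Ideal.span {x}) ≃ₗ[R] QuotSMulTop x R := Submodule.quotEquivOfEq _ _ h
        rw [← e.isWeaklyRegular_congr]
        exact (isWeaklyRegular_map_algebraMap_iff (R := R) (S := R ⧸ Ideal.span {x})
          (R ⧸ Ideal.span {x}) ss).1 hrs

lemma exists_isWeaklyRegular_of_flat {R : Type*} [CommRing R] [IsRegularLocalRing R]
    {n : ℕ} (hn : ringKrullDim R = n) (M : Type*) [AddCommGroup M] [Module R M] [Module.Flat R M] :
    ∃ rs : List R, rs.length = n ∧ (∀ r ∈ rs, r ∈ maximalIdeal R) ∧ IsWeaklyRegular M rs := by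
  obtain ⟨rs, h1, h2, h3⟩ := exists_isWeaklyRegular_self R hn
  refine ⟨rs, h1, h2, ?_⟩
  exact ((TensorProduct.rid R M).isWeaklyRegular_congr rs).1
    (IsWeaklyRegular.isWeaklyRegular_lTensor (M₂ := M) h3)

/-- Depth is bounded by dimension. -/
lemma depth_le_ringKrullDim (R : Type u) [CommRing R] [IsLocalRing R] [IsNoetherianRing R]
    (M : Type u) [AddCommGroup M] [Module R M] [Module.Finite R M] :
    depth R M ≤ ringKrullDim R := by
  refine iSup_le ?_
  rintro ⟨rs, hrs⟩
  have h := Module.supportDim_add_length_eq_supportDim_of_isRegular rs hrs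
  have := hrs.quot_ofList_smul_nontrivial ⊤
  have h0 : Module.supportDim R (M ⧸ Ideal.ofList rs • (⊤ : Submodule R M)) ≠ ⊥ :=
    Module.supportDim_ne_bot_of_nontrivial R _
  have h1 : (rs.length : WithBot ℕ∞) ≤ Module.supportDim R M := by
    rw [← h]
    generalize Module.supportDim R (M ⧸ Ideal.ofList rs • (⊤ : Submodule R M)) = a at h0
    obtain ⟨a, rfl⟩ := WithBot.ne_bot_iff_exists.1 h0
    norm_cast
    exact le_add_self
  exact h1.trans (Module.supportDim_le_ringKrullDim R M)

/-- Over a local ring a finite nonzero module with a weakly regular sequence in the maximal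
ideal of length `dim R` has depth `dim R`. -/
lemma depth_eq_ringKrullDim_of_isWeaklyRegular {R : Type u} [CommRing R] [IsLocalRing R]
    [IsNoetherianRing R] {M : Type u} [AddCommGroup M] [Module R M] [Module.Finite R M]
    [Nontrivial M] {rs : List R} (hlen : (rs.length : WithBot ℕ∞) = ringKrullDim R)
    (hmem : ∀ r ∈ rs, r ∈ maximalIdeal R) (hrs : IsWeaklyRegular M rs) :
    depth R M = ringKrullDim R := by
  refine le_antisymm (depth_le_ringKrullDim R M) ?_
  rw [← hlen]
  exact le_iSup_of_le (f := fun rs : {rs : List R // IsRegular M rs} =>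
    (rs.1.length : WithBot ℕ∞)) ⟨rs, .of_isWeaklyRegular_of_mem_maximalIdeal M hmem hrs⟩ le_rfl

/-- The members of a regular sequence on a nonzero module over a local ring are non-units. -/
lemma exists_isWeaklyRegular_of_depth_eq {R : Type u} [CommRing R] [IsLocalRing R]
    {M : Type u} [AddCommGroup M] [Module R M] [Module.Finite R M] {n : ℕ} (h : depth R M = n) :
    ∃ rs : List R, n ≤ rs.length ∧ (∀ r ∈ rs, r ∈ maximalIdeal R) ∧ IsWeaklyRegular M rs := by
  obtain ⟨rs, hrs, hn⟩ : ∃ rs : List R, IsRegular M rs ∧ n ≤ rs.length := by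
    by_contra! hcon
    rcases n with _ | n
    · rcases isEmpty_or_nonempty {rs : List R // IsRegular M rs} with he | ⟨⟨rs, hrs⟩⟩
      · rw [depth, iSup_of_empty] at h
        exact absurd h (by simp)
      · exact absurd (hcon rs hrs) (by simp)
    · have : depth R M ≤ n := iSup_le fun rs => by
        exact_mod_cast Nat.lt_succ_iff.1 (hcon rs.1 rs.2)
      rw [h] at this
      exact absurd (Nat.cast_le.1 this) (by simp)
  refine ⟨rs, hn, fun r hr => ?_, hrs.toIsWeaklyRegular⟩
  by_contra hr'
  have hu : IsUnit r := by simpa using hr'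
  refine hrs.top_ne_smul ?_
  rw [Ideal.eq_top_of_isUnit_mem (Ideal.ofList rs) (Ideal.subset_span hr) hu, Submodule.top_smul]

end RegularLocal

/-! ### Projective dimension over a module-finite algebra -/

section ProjectiveDimension

open IsLocalRing RingTheory.Sequence
open scoped Pointwise

lemma shortExact_of_exact {B : Type u} [Ring B] {X Y Z : Type u} [AddCommGroup X] [Module B X]
    [AddCommGroup Y] [Module B Y] [AddCommGroup Z] [Module B Z] {f : X →ₗ[B] Y} {g : Y →ₗ[B] Z}
    (hf : Function.Injective f) (hfg : Function.Exact f g) (hg : Function.Surjective g) :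
    (ModuleCat.shortComplexOfCompEqZero f g hfg.linearMap_comp_eq_zero).ShortExact where
  exact := (ShortComplex.ShortExact.moduleCat_exact_iff_function_exact _).mpr hfg
  mono_f := (ModuleCat.mono_iff_injective _).mpr hf
  epi_g := (ModuleCat.epi_iff_surjective _).mpr hg

variable {R : Type u} [CommRing R] {B : Type u} [Ring B] [Algebra R B]

/-- Multiplication by `x ∈ R` on a module over the `R`-algebra `B`, as a `B`-linear map. -/
def homothety (B : Type u) [Ring B] [Algebra R B] (x : R) (N : Type u) [AddCommGroup N] [Module R N]
    [Module B N] [IsScalarTower R B N] : N →ₗ[B] N :=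
  haveI : SMulCommClass B R N := IsScalarTower.to_smulCommClass'
  x • LinearMap.id

/-- `N / xN`, as a `B`-module. -/
abbrev QuotHomothety (B : Type u) [Ring B] [Algebra R B] (x : R) (N : Type u) [AddCommGroup N]
    [Module R N] [Module B N] [IsScalarTower R B N] :=
  N ⧸ LinearMap.range (homothety B x N)

lemma isWeaklyRegular_quotHomothety_iff {x : R} {N : Type u} [AddCommGroup N] [Module R N]
    [Module B N] [IsScalarTower R B N] (rs : List R) :
    IsWeaklyRegular (QuotHomothety B x N) rs ↔ IsWeaklyRegular (QuotSMulTop x N) rs := by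
  have h : (LinearMap.range (homothety B x N)).restrictScalars R = x • (⊤ : Submodule R N) := by
    ext n
    rw [Submodule.mem_smul_pointwise_iff_exists]
    exact ⟨fun ⟨m, hm⟩ => ⟨m, trivial, hm⟩, fun ⟨m, _, hm⟩ => ⟨m, hm⟩⟩
  exact ((Submodule.Quotient.restrictScalarsEquiv R (LinearMap.range (homothety B x N))).symm.trans
    (Submodule.quotEquivOfEq _ _ h)).isWeaklyRegular_congr rs

/-- The kernel `K` of a surjection `F → N` from a projective module yields an exact sequence
`0 → K/xK → F/xF → N/xN → 0`, as `x` is regular on `N`, and `F/xF` has projective dimension at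
most one. -/
lemma hasProjectiveDimensionLT_quotHomothety_ker [IsDomain R] {F N : Type u} [AddCommGroup F]
    [Module R F] [Module B F] [IsScalarTower R B F] [AddCommGroup N] [Module R N] [Module B N]
    [IsScalarTower R B N] {x : R} (hreg : IsSMulRegular N x) (hregF : IsSMulRegular F x)
    [Module.Projective B F] (p : F →ₗ[B] N) (hp : Function.Surjective p) (k : ℕ)
    (h : HasProjectiveDimensionLT (ModuleCat.of B (QuotHomothety B x N)) (k + 3)) :
    HasProjectiveDimensionLT (ModuleCat.of B (QuotHomothety B x (LinearMap.ker p))) (k + 2) := by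
  have hpR : ∀ u : F, p (x • u) = x • p u := fun u => by
    rw [← algebraMap_smul B x u, map_smul, algebraMap_smul]
  have hF : HasProjectiveDimensionLT (ModuleCat.of B (QuotHomothety B x F)) (k + 2) := by
    have : Projective (ModuleCat.of B F) := (IsProjective.iff_projective F).1 inferInstance
    have h2 := (shortExact_of_exact (f := homothety B x F)
      (g := (LinearMap.range (homothety B x F)).mkQ) hregF
      (LinearMap.exact_map_mkQ_range _) (Submodule.mkQ_surjective _)).hasProjectiveDimensionLT_X₃
      (k + 1) (by
        have : HasProjectiveDimensionLT (ModuleCat.of B F) (k + 1) :=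
          hasProjectiveDimensionLT_of_ge _ 1 _ (by omega)
        exact this) (by
        have : HasProjectiveDimensionLT (ModuleCat.of B F) (k + 2) :=
          hasProjectiveDimensionLT_of_ge _ 1 _ (by omega)
        exact this)
    exact h2
  let a : QuotHomothety B x (LinearMap.ker p) →ₗ[B] QuotHomothety B x F :=
    Submodule.mapQ _ _ (LinearMap.ker p).subtype (by rintro _ ⟨k, rfl⟩; exact ⟨k, rfl⟩)
  let b : QuotHomothety B x F →ₗ[B] QuotHomothety B x N :=
    Submodule.mapQ _ _ p (by rintro _ ⟨k, rfl⟩; exact ⟨p k, (hpR k).symm⟩)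
  refine (shortExact_of_exact (f := a) (g := b) ?_ ?_ ?_).hasProjectiveDimensionLT_X₁ (k + 2) hF h
  · rw [injective_iff_map_eq_zero]
    intro c hc
    obtain ⟨c, rfl⟩ := Submodule.mkQ_surjective _ c
    obtain ⟨u, hu⟩ := (Submodule.Quotient.mk_eq_zero _).1 hc
    refine (Submodule.Quotient.mk_eq_zero _).2 ⟨⟨u, hreg ?_⟩, Subtype.ext hu⟩
    change x • p u = x • 0
    rw [← hpR, smul_zero]
    exact (congrArg p hu).trans c.2
  · intro c
    obtain ⟨c, rfl⟩ := Submodule.mkQ_surjective _ c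
    constructor
    · intro hc
      obtain ⟨n, hn⟩ := (Submodule.Quotient.mk_eq_zero _).1 hc
      obtain ⟨u, rfl⟩ := hp n
      refine ⟨Submodule.Quotient.mk ⟨c - x • u, ?_⟩, ?_⟩
      · rw [LinearMap.mem_ker, map_sub, hpR, sub_eq_zero]; exact hn.symm
      · refine (Submodule.Quotient.eq _).2 ⟨-u, ?_⟩
        change x • (-u) = c - x • u - c
        rw [smul_neg]; abel
    · rintro ⟨d, hd⟩
      obtain ⟨d, rfl⟩ := Submodule.mkQ_surjective _ d
      rw [← hd]
      refine (Submodule.Quotient.mk_eq_zero _).2 ⟨0, ?_⟩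
      rw [map_zero]; exact d.2.symm
  · intro c
    obtain ⟨c, rfl⟩ := Submodule.mkQ_surjective _ c
    obtain ⟨u, rfl⟩ := hp c
    exact ⟨Submodule.Quotient.mk u, rfl⟩

variable [IsLocalRing R] [IsNoetherianRing R]

/-- If `x` is a parameter regular on `N = F / K`, and the preimage `K + xF` of `xN` in the
projective module `F` is projective, then `N` is projective.  Lifting the map `K + xF → xN ≃ N`
to `F` yields `h : F → K` that is congruent to the identity modulo `x` on `K`, hence
an automorphism of `K`, so that `K` is a direct summand of `F`. -/
lemma projective_of_projective_comap {F N : Type u} [AddCommGroup F] [Module R F] [Module B F]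
    [IsScalarTower R B F] [Module.Finite R F] [AddCommGroup N] [Module R N] [Module B N]
    [IsScalarTower R B N] {x : R} (hx : x ∈ maximalIdeal R) (hreg : IsSMulRegular N x)
    [Module.Projective B F] (p : F →ₗ[B] N) (hp : Function.Surjective p)
    (hK : Module.Projective B ((LinearMap.range (homothety B x N)).comap p)) :
    Module.Projective B N := by
  set K' := (LinearMap.range (homothety B x N)).comap p with hK'
  let e : N ≃ₗ[B] LinearMap.range (homothety B x N) :=
    LinearEquiv.ofInjective (homothety B x N) hreg
  let q : K' →ₗ[B] N := e.symm.toLinearMap ∘ₗ p.restrict (p := K') (fun _ h => h)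
  have hq : ∀ u : K', x • q u = p u := fun u =>
    congrArg Subtype.val (e.apply_symm_apply (p.restrict (p := K') (fun _ h => h) u))
  obtain ⟨θ, hθ⟩ := Module.projective_lifting_property p q hp
  have hpR : ∀ u : F, p (x • u) = x • p u := fun u => by
    rw [← algebraMap_smul B x u, map_smul, algebraMap_smul]
  let ι : F →ₗ[B] K' := (homothety B x F).codRestrict K' (fun u => ⟨p u, (hpR u).symm⟩)
  have hι : ∀ u, q (ι u) = p u := fun u => hreg ((hq _).trans (hpR u))
  let K := LinearMap.ker p
  have : IsNoetherian R K := inferInstanceAs (IsNoetherian R (K.restrictScalars R))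
  let h : F →ₗ[B] K := (LinearMap.id - θ ∘ₗ ι).codRestrict K (fun u => by
    change p (u - θ (ι u)) = 0
    rw [map_sub, ← hι u, ← LinearMap.comp_apply p θ, hθ, sub_self])
  have hsurj : Function.Surjective (h ∘ₗ K.subtype) := by
    rw [← LinearMap.range_eq_top]
    have hR : (LinearMap.range (h ∘ₗ K.subtype)).restrictScalars R = ⊤ := by
      refine top_le_iff.1 (Submodule.le_of_le_smul_of_le_jacobson_bot (I := maximalIdeal R)
        (IsNoetherian.noetherian _) (IsLocalRing.maximalIdeal_le_jacobson _) ?_)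
      intro k _
      have hkK' : (k : F) ∈ K' := ⟨0, by rw [map_zero]; exact k.2.symm⟩
      have hqk : q ⟨k, hkK'⟩ = 0 := hreg (by
        change x • q ⟨k, hkK'⟩ = x • 0
        rw [hq, smul_zero]; exact k.2)
      have hθk : θ ⟨k, hkK'⟩ ∈ K := by
        change p _ = 0
        rw [← LinearMap.comp_apply, hθ, hqk]
      have key : k = (h ∘ₗ K.subtype) k + x • (⟨θ ⟨k, hkK'⟩, hθk⟩ : K) := by
        ext
        change (k : F) = (k - θ (ι k)) + x • θ ⟨k, hkK'⟩
        have : ι k = algebraMap R B x • ⟨k, hkK'⟩ := by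
          ext; exact (algebraMap_smul B x (k : F)).symm
        rw [this, map_smul, algebraMap_smul, sub_add_cancel]
      rw [key]
      exact Submodule.add_mem_sup ⟨k, rfl⟩ (Submodule.smul_mem_smul hx Submodule.mem_top)
    ext k
    exact ⟨fun _ => trivial, fun _ => by
      have : k ∈ (LinearMap.range (h ∘ₗ K.subtype)).restrictScalars R := hR ▸ trivial
      exact this⟩
  have hbij : Function.Bijective (h ∘ₗ K.subtype) := by
    refine ⟨?_, hsurj⟩
    exact IsNoetherian.injective_of_surjective_endomorphism
      ((h ∘ₗ K.subtype).restrictScalars R) hsurj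
  let g := LinearEquiv.ofBijective _ hbij
  let r : F →ₗ[B] F := LinearMap.id - K.subtype ∘ₗ g.symm.toLinearMap ∘ₗ h
  have hr : K ≤ LinearMap.ker r := by
    intro k hk
    change k - (g.symm (h k) : F) = 0
    have : g.symm (h k) = ⟨k, hk⟩ := g.symm_apply_apply ⟨k, hk⟩
    rw [this, sub_self]
  let i : N →ₗ[B] F := K.liftQ r hr ∘ₗ (p.quotKerEquivOfSurjective hp).symm.toLinearMap
  refine Module.Projective.of_split i p ?_
  ext n
  obtain ⟨u, rfl⟩ := hp n
  have : (p.quotKerEquivOfSurjective hp).symm (p u) = Submodule.Quotient.mk u :=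
    (LinearEquiv.symm_apply_eq _).2 rfl
  change p (K.liftQ r hr ((p.quotKerEquivOfSurjective hp).symm (p u))) = p u
  rw [this]
  change p (u - (g.symm (h u) : F)) = p u
  rw [map_sub, show p (g.symm (h u) : F) = 0 from (g.symm (h u)).2, sub_zero]

variable [Module.Finite R B]

/-- Over a module-finite algebra, dividing a finite module by a parameter that is regular on it
raises the projective dimension by at least one. For a larger `k` one passes to a syzygy. -/
lemma hasProjectiveDimensionLT_of_quotHomothety [IsDomain R] [Module.IsTorsionFree R B] {N : Type u}
    [AddCommGroup N] [Module R N] [Module B N] [IsScalarTower R B N] [Module.Finite B N] {x : R}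
    (hx : x ∈ maximalIdeal R) (hreg : IsSMulRegular N x) (k : ℕ)
    (h : HasProjectiveDimensionLT (ModuleCat.of B (QuotHomothety B x N)) (k + 2)) :
    HasProjectiveDimensionLT (ModuleCat.of B N) (k + 1) := by
  by_cases hx0 : x = 0
  · subst hx0
    have : Subsingleton N := ⟨fun a b => hreg (by simp)⟩
    have := (ModuleCat.isZero_of_subsingleton (ModuleCat.of B N)).hasProjectiveDimensionLT_zero
    exact hasProjectiveDimensionLT_of_ge _ 0 _ (by omega)
  induction k generalizing N with
  | zero =>
    obtain ⟨n, p, hp⟩ := Module.Finite.exists_fin' B N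
    rw [zero_add, ← projective_iff_hasProjectiveDimensionLT_one, ← IsProjective.iff_projective]
    refine projective_of_projective_comap hx hreg p hp ?_
    rw [IsProjective.iff_projective, projective_iff_hasProjectiveDimensionLT_one]
    let q := (LinearMap.range (homothety B x N)).mkQ ∘ₗ p
    have hq : Function.Surjective q := (Submodule.mkQ_surjective _).comp hp
    have hker : LinearMap.ker q = (LinearMap.range (homothety B x N)).comap p := by
      rw [LinearMap.ker_comp, Submodule.ker_mkQ]
    rw [← hker]
    have : Projective (ModuleCat.of B (Fin n → B)) :=
      (IsProjective.iff_projective _).1 inferInstance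
    exact (LinearMap.shortExact_shortComplexKer hq).hasProjectiveDimensionLT_X₁ 1
      (inferInstanceAs (HasProjectiveDimensionLT (ModuleCat.of B (Fin n → B)) 1)) h
  | succ k ih =>
    obtain ⟨n, p, hp⟩ := Module.Finite.exists_fin' B N
    have hF : IsSMulRegular (Fin n → B) x := IsSMulRegular.of_ne_zero hx0
    have hfin : IsNoetherianRing B := isNoetherian_of_tower R inferInstance
    have hK := ih (N := LinearMap.ker p)
      (fun a b hab => Subtype.ext (hF (congrArg Subtype.val hab)))
      (hasProjectiveDimensionLT_quotHomothety_ker hreg hF p hp k h)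
    have : Projective (ModuleCat.of B (Fin n → B)) :=
      (IsProjective.iff_projective _).1 inferInstance
    exact (LinearMap.shortExact_shortComplexKer hp).hasProjectiveDimensionLT_X₃ (k + 1) hK
      (hasProjectiveDimensionLT_of_ge (ModuleCat.of B (Fin n → B)) 1 _ (by omega))

/-- One half of the Auslander-Buchsbaum formula over `B`: a regular sequence of length `l` on `N`
bounds the projective dimension of `N` by `gl.dim B - l`. -/
lemma hasProjectiveDimensionLT_of_isWeaklyRegular [IsDomain R] [Module.IsTorsionFree R B]
    {N : Type u} [AddCommGroup N] [Module R N] [Module B N] [IsScalarTower R B N]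
    [Module.Finite B N] (rs : List R) (hmem : ∀ r ∈ rs, r ∈ maximalIdeal R)
    (hrs : IsWeaklyRegular N rs) (k : ℕ) (hB : globalDimension B ≤ (k + rs.length : ℕ)) :
    HasProjectiveDimensionLT (ModuleCat.of B N) (k + 1) := by
  induction rs generalizing N k with
  | nil =>
    exact (projectiveDimension_le_iff _ _).1 ((le_iSup (fun M : ModuleCat.{u} B =>
      projectiveDimension M) _).trans hB)
  | cons x rs ih =>
    rw [isWeaklyRegular_cons_iff, ← isWeaklyRegular_quotHomothety_iff (B := B)] at hrs
    refine hasProjectiveDimensionLT_of_quotHomothety (hmem x (by simp)) hrs.1 k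
      (ih (fun r hr => hmem r (by simp [hr])) hrs.2 (k + 1) ?_)
    rwa [List.length_cons, Nat.add_comm rs.length, ← Nat.add_assoc] at hB

end ProjectiveDimension

/-! ### The depth of a cokernel -/

section Cokernel

open IsLocalRing RingTheory.Sequence CategoryTheory.Abelian

variable {R : Type u} [CommRing R] [IsRegularLocalRing R]

/-- A flat module has depth `dim R`, so by Rees its lower `Ext` groups from the residue field
vanish. -/
lemma subsingleton_ext_residueField_of_flat {n : ℕ} (hn : ringKrullDim R = n) (M : Type u)
    [AddCommGroup M] [Module R M] [Module.Finite R M] [Module.Flat R M] (i : ℕ) (hi : i < n) :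
    Subsingleton (Ext (ModuleCat.of R (Shrink.{u} (R ⧸ maximalIdeal R))) (ModuleCat.of R M) i) := by
  rcases subsingleton_or_nontrivial M with hM | hM
  · refine ⟨fun a b => ?_⟩
    have h0 := (ModuleCat.isZero_of_subsingleton (ModuleCat.of R M)).eq_of_src (𝟙 _) 0
    rw [← a.comp_mk₀_id, ← b.comp_mk₀_id, h0, Ext.mk₀_zero, Ext.comp_zero, Ext.comp_zero]
  · obtain ⟨rs, h1, h2, h3⟩ := exists_isWeaklyRegular_of_flat hn M
    have htfae := ModuleCat.exists_isRegular_tfae (maximalIdeal R) n (ModuleCat.of R M)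
      (lt_top_iff_ne_top.2 (Submodule.top_ne_ideal_smul_of_le_jacobson_annihilator
        (maximalIdeal_le_jacobson _)).symm)
    have h31 := (htfae.out 3 1).1
    exact h31 ⟨rs, h1, h2, .of_isWeaklyRegular_of_mem_maximalIdeal M h2 h3⟩ i hi

/-- The depth lemma for the cokernel of an injection of free modules: by the long exact sequence,
`Ext^i(k, N)` vanishes for `i < dim R - 1`. -/
lemma exists_isWeaklyRegular_of_exact {n : ℕ} (hn : ringKrullDim R = (n + 1 : ℕ))
    {M₀ M₁ N : Type u} [AddCommGroup M₀] [Module R M₀] [Module.Finite R M₀] [Module.Flat R M₀]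
    [AddCommGroup M₁] [Module R M₁] [Module.Finite R M₁] [Module.Flat R M₁]
    [AddCommGroup N] [Module R N] {φ : M₀ →ₗ[R] M₁} {π : M₁ →ₗ[R] N}
    (hφ : Function.Injective φ) (hφπ : Function.Exact φ π) (hπ : Function.Surjective π) :
    ∃ rs : List R, rs.length = n ∧ (∀ r ∈ rs, r ∈ maximalIdeal R) ∧ IsWeaklyRegular N rs := by
  have : Module.Finite R N := Module.Finite.of_surjective π hπ
  rcases subsingleton_or_nontrivial N with hN | hN
  · obtain ⟨rs, h1, h2, -⟩ := exists_isWeaklyRegular_of_flat hn R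
    refine ⟨rs.tail, by simp [h1], fun r hr => h2 r (List.mem_of_mem_tail hr), ?_⟩
    exact ⟨fun i _ => Function.injective_of_subsingleton _⟩
  have hS := shortExact_of_exact hφ hφπ hπ
  obtain ⟨rs, h1, h2, h3⟩ := ((ModuleCat.exists_isRegular_tfae (maximalIdeal R) n
    (ModuleCat.of R N) (lt_top_iff_ne_top.2
      (Submodule.top_ne_ideal_smul_of_le_jacobson_annihilator
        (maximalIdeal_le_jacobson _)).symm)).out 1 3).1 (fun i hi => by
    refine ⟨fun a b => ?_⟩
    rw [← sub_eq_zero]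
    generalize a - b = c
    have h0 := subsingleton_ext_residueField_of_flat hn M₀ (i + 1) (by omega)
    have h1 := subsingleton_ext_residueField_of_flat hn M₁ i (by omega)
    obtain ⟨d, rfl⟩ := Ext.covariant_sequence_exact₃ _ hS c rfl (h0.elim _ _)
    rw [h1.elim d 0, Ext.zero_comp])
  exact ⟨rs, h1, h2, h3.toIsWeaklyRegular⟩

end Cokernel

/-! ### Local endomorphism rings over a complete local ring -/

section LocalEndomorphisms

open IsLocalRing

/-- A finite module over a complete Noetherian local ring is complete. -/
lemma isAdicComplete_of_finite {R : Type*} [CommRing R] [IsNoetherianRing R] [IsLocalRing R]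
    [IsAdicComplete (maximalIdeal R) R] (M : Type*) [AddCommGroup M] [Module R M]
    [Module.Finite R M] : IsAdicComplete (maximalIdeal R) M where
  toIsPrecomplete := by
    rw [← AdicCompletion.of_surjective_iff]
    intro y
    obtain ⟨t, rfl⟩ := AdicCompletion.ofTensorProduct_surjective_of_finite (maximalIdeal R) M y
    induction t using TensorProduct.induction_on with
    | zero => exact ⟨0, by simp⟩
    | tmul r m =>
      obtain ⟨r, rfl⟩ := AdicCompletion.of_surjective (maximalIdeal R) R r
      refine ⟨r • m, ?_⟩
      rw [AdicCompletion.ofTensorProduct_tmul, map_smul]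
      have : AdicCompletion.of (maximalIdeal R) R r = algebraMap R _ r := rfl
      rw [this, algebraMap_smul]
    | add a b ha hb =>
      obtain ⟨c, hc⟩ := ha
      obtain ⟨d, hd⟩ := hb
      exact ⟨c + d, by rw [map_add, map_add, hc, hd]⟩

/-- In an Artinian ring, the stable ideal `(xⁿ)` is generated by an idempotent; `x` is invertible on
this factor of the ring and nilpotent on the complementary one. -/
lemma exists_isIdempotentElem_of_isArtinianRing {A : Type*} [CommRing A] [IsArtinianRing A]
    (x : A) : ∃ e : A, IsIdempotentElem e ∧ (e = 0 → IsNilpotent x) ∧ (e = 1 → IsUnit x) := by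
  obtain ⟨n, y, h⟩ := IsArtinian.exists_pow_succ_smul_dvd x (1 : A)
  simp only [smul_eq_mul, mul_one, Nat.succ_eq_add_one] at h
  have hk : ∀ k, x ^ (n + k) * y ^ k = x ^ n := by
    intro k
    induction k with
    | zero => simp
    | succ k ih => linear_combination ih + x ^ k * y ^ k * h
  have hn := hk n
  refine ⟨x ^ n * y ^ n, ?_, fun h0 => ⟨n, ?_⟩, fun h1 => ?_⟩
  · rw [IsIdempotentElem, mul_mul_mul_comm, ← pow_add, ← mul_assoc, hn]
  · rw [← hn, pow_add, mul_assoc, h0, mul_zero]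
  · have hu : IsUnit (x ^ n) := .of_mul_eq_one _ h1
    refine .of_mul_eq_one y (hu.mul_left_cancel ?_)
    rw [mul_one, ← mul_assoc, ← pow_succ, h]

/-- The commutative case of `isUnit_or_isUnit_one_sub`: idempotents lift from the Artinian ring
`S / 𝔪S`, since `S` is Henselian along `𝔪S`. -/
lemma isUnit_or_isUnit_one_sub_of_commRing {R : Type*} [CommRing R] [IsNoetherianRing R]
    [IsLocalRing R] [IsAdicComplete (maximalIdeal R) R] {S : Type*} [CommRing S] [Algebra R S]
    [Module.Finite R S] (hS : ∀ e : S, IsIdempotentElem e → e = 0 ∨ e = 1) (x : S) :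
    IsUnit x ∨ IsUnit (1 - x) := by
  -- the polynomial `X² - X` below is monic of degree two only over a nonzero ring
  nontriviality S
  set I := (maximalIdeal R).map (algebraMap R S) with hI
  have hc : IsAdicComplete I S := (IsAdicComplete.map_algebraMap_iff _ _).2
    (isAdicComplete_of_finite (R := R) S)
  have hH : HenselianRing S I := IsAdicComplete.henselianRing S I
  let _ : Algebra (R ⧸ maximalIdeal R) (S ⧸ I) :=
    Ideal.Quotient.algebraQuotientOfLEComap Ideal.le_comap_map
  let _ : Field (R ⧸ maximalIdeal R) := Ideal.Quotient.field _
  have : IsScalarTower R (R ⧸ maximalIdeal R) (S ⧸ I) := IsScalarTower.of_algebraMap_eq' rfl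
  have : Module.Finite (R ⧸ maximalIdeal R) (S ⧸ I) :=
    Module.Finite.of_restrictScalars_finite R _ _
  have : IsArtinianRing (S ⧸ I) := IsArtinianRing.of_finite (R ⧸ maximalIdeal R) _
  have hloc := isLocalHom_of_le_jacobson_bot I hH.jac
  obtain ⟨e, he, he0, he1⟩ := exists_isIdempotentElem_of_isArtinianRing (Ideal.Quotient.mk I x)
  obtain ⟨a₀, rfl⟩ := Ideal.Quotient.mk_surjective e
  -- an idempotent modulo `I` is a simple root of `X² - X`
  obtain ⟨a, ha, haI⟩ := hH.is_henselian (Polynomial.X ^ 2 - Polynomial.X)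
    (Polynomial.monic_X_pow_sub (by rw [Polynomial.degree_X]; decide)) a₀ (by
      rw [← Ideal.Quotient.eq_zero_iff_mem]
      simp only [Polynomial.eval_sub, Polynomial.eval_pow, Polynomial.eval_X, map_sub, map_pow]
      rw [pow_two, he.eq, sub_self])
    (by
      refine .of_mul_eq_one (2 * Ideal.Quotient.mk I a₀ - 1) ?_
      have hd : (Polynomial.X ^ 2 - Polynomial.X : Polynomial S).derivative.eval a₀ =
          2 * a₀ - 1 := by
        simp [one_add_one_eq_two]
      have h2 : Ideal.Quotient.mk I (2 : S) = 2 := map_ofNat _ 2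
      rw [hd, map_sub, map_mul, map_one, h2]
      linear_combination 4 * he.eq)
  have ha' : IsIdempotentElem a := by
    have : a ^ 2 - a = 0 := by simpa using ha
    rw [IsIdempotentElem, ← pow_two]; exact sub_eq_zero.1 this
  have hmk : Ideal.Quotient.mk I a = Ideal.Quotient.mk I a₀ := Ideal.Quotient.eq.2 haI
  rcases hS a ha' with rfl | rfl
  · right
    refine hloc.map_nonunit _ ?_
    rw [map_sub, map_one]
    exact (he0 (by rw [← hmk, map_zero])).isUnit_one_sub
  · left
    exact hloc.map_nonunit _ (he1 (by rw [← hmk, map_one]))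

/-- A module-finite algebra over a complete Noetherian local ring that has only the trivial
idempotents is local. It suffices to treat the commutative subalgebra `R[x]`. -/
lemma isUnit_or_isUnit_one_sub {R : Type*} [CommRing R] [IsNoetherianRing R]
    [IsLocalRing R] [IsAdicComplete (maximalIdeal R) R] {E : Type*} [Ring E] [Algebra R E]
    [Module.Finite R E] (hE : ∀ e : E, IsIdempotentElem e → e = 0 ∨ e = 1) (x : E) :
    IsUnit x ∨ IsUnit (1 - x) := by
  let g : Polynomial R →ₐ[R] E := Polynomial.aeval x
  -- the commutative subalgebra generated by `x`
  let S := Polynomial R ⧸ RingHom.ker g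
  let j : S →ₐ[R] E := Ideal.Quotient.liftₐ (RingHom.ker g) g (fun a ha => ha)
  have hj : Function.Injective j := RingHom.kerLift_injective g.toRingHom
  have : IsNoetherian R E := isNoetherian_of_isNoetherianRing_of_finite R E
  have : Module.Finite R S := Module.Finite.of_injective j.toLinearMap hj
  let y : S := Ideal.Quotient.mk _ Polynomial.X
  have hy : j y = x := Polynomial.aeval_X x
  have h := isUnit_or_isUnit_one_sub_of_commRing (R := R) (S := S) (fun e he => by
    rcases hE (j e) (he.map j) with h | h
    · exact Or.inl (hj (h.trans (map_zero j).symm))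
    · exact Or.inr (hj (h.trans (map_one j).symm))) y
  rcases h with h | h
  · exact Or.inl (hy ▸ h.map j)
  · refine Or.inr ?_
    have := h.map j
    rwa [map_sub, map_one, hy] at this

end LocalEndomorphisms

/-! ### Modules over the skew group ring: even and odd parts -/

section SkewGroupRing

variable {R : Type u} [CommRing R] {B : Type u} [Ring B] [Algebra R B] {f : R}

lemma inclB_algebraMap (r : R) : inclB R B f (algebraMap R B r) = algebraMap R (Lam R B f) r := by
  have h1 : algebraMap R (Lam R B f) r = r • (1 : Lam R B f) := Algebra.algebraMap_eq_smul_one r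
  rw [h1, inclB_apply]
  have h2 : (1 : Lam R B f) = single R B f 1 1 := rfl
  have h3 : r • single R B f 1 1 = single R B f 1 (r • 1) := SkewMonoidAlgebra.smul_single _ _ _
  rw [h2, h3, Algebra.algebraMap_eq_smul_one, TensorProduct.tmul_smul]
  rfl

lemma zLam_mul_inclB (b : B) : zLam R B f * inclB R B f b = inclB R B f b * zLam R B f := by
  rw [inclB_apply, zLam, single_mul_single, single_mul_single, one_smul, one_smul,
    Algebra.TensorProduct.tmul_mul_tmul, Algebra.TensorProduct.tmul_mul_tmul]
  simp

lemma sigmaLam_mul_sigmaLam : sigmaLam R B f * sigmaLam R B f = 1 := by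
  rw [sigmaLam, single_mul_single, smul_one, mul_one]
  rfl

lemma exists_eq_tmul_add_tmul (x : DoubleCover R B f) :
    ∃ b c : B, x = 1 ⊗ₜ[R] b + QuadraticAlgebra.omega ⊗ₜ[R] c := by
  induction x using TensorProduct.induction_on with
  | zero => exact ⟨0, 0, by simp⟩
  | tmul a b =>
    refine ⟨a.re • b, a.im • b, ?_⟩
    rw [← TensorProduct.smul_tmul, ← TensorProduct.smul_tmul, ← TensorProduct.add_tmul]
    congr 1
    ext
    · change a.re = a.re * 1 + a.im * 0
      ring
    · change a.im = a.re * 0 + a.im * 1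
      ring
  | add x y hx hy =>
    obtain ⟨b, c, rfl⟩ := hx
    obtain ⟨b', c', rfl⟩ := hy
    exact ⟨b + b', c + c', by rw [TensorProduct.tmul_add, TensorProduct.tmul_add]; abel⟩

lemma exists_single_one_eq (x : DoubleCover R B f) :
    ∃ b c : B, single R B f 1 x = inclB R B f b + zLam R B f * inclB R B f c := by
  obtain ⟨b, c, rfl⟩ := exists_eq_tmul_add_tmul x
  refine ⟨b, c, ?_⟩
  have hz : zLam R B f * inclB R B f c = single R B f 1 (QuadraticAlgebra.omega ⊗ₜ[R] c) := by
    rw [inclB_apply, zLam, single_mul_single, one_smul, Algebra.TensorProduct.tmul_mul_tmul,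
      mul_one, one_mul, mul_one]
  rw [hz, inclB_apply]
  exact SkewMonoidAlgebra.single_add _ _ _

lemma Lam.induction {p : Lam R B f → Prop} (zero : p 0) (single : ∀ g x, p (single R B f g x))
    (add : ∀ x y, p x → p y → p (x + y)) (l : Lam R B f) : p l :=
  SkewMonoidAlgebra.induction_on l zero single add

/-- `Λ` is generated by `1`, `z`, `σ`, `zσ` over `B`. -/
lemma exists_eq_add_mul_sigmaLam (l : Lam R B f) :
    ∃ b c b' c' : B, l = (inclB R B f b + zLam R B f * inclB R B f c) +
      (inclB R B f b' + zLam R B f * inclB R B f c') * sigmaLam R B f := by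
  induction l using Lam.induction with
  | zero => exact ⟨0, 0, 0, 0, by simp⟩
  | single g x =>
    obtain ⟨b, c, h⟩ := exists_single_one_eq x
    have hg : g = 1 ∨ g = genGf := by revert g; decide
    rcases hg with rfl | rfl
    · exact ⟨b, c, 0, 0, by simp [h]⟩
    · refine ⟨0, 0, b, c, ?_⟩
      rw [← h, sigmaLam, single_mul_single, one_smul, mul_one, one_mul]
      simp
  | add x y hx hy =>
    obtain ⟨b₁, b₂, b₃, b₄, rfl⟩ := hx
    obtain ⟨c₁, c₂, c₃, c₄, rfl⟩ := hy
    refine ⟨b₁ + c₁, b₂ + c₂, b₃ + c₃, b₄ + c₄, ?_⟩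
    simp only [map_add, mul_add, add_mul]
    abel

instance [Module.Finite R B] : Module.Finite R (Lam R B f) := by
  have hB : ∀ (r : R) (b : B), inclB R B f (r • b) = r • inclB R B f b := fun r b => by
    rw [Algebra.smul_def, map_mul, inclB_algebraMap, ← Algebra.smul_def]
  let g : B × B × B × B →ₗ[R] Lam R B f :=
    { toFun := fun t => (inclB R B f t.1 + zLam R B f * inclB R B f t.2.1) +
        (inclB R B f t.2.2.1 + zLam R B f * inclB R B f t.2.2.2) * sigmaLam R B f
      map_add' := fun s t => by
        simp only [Prod.fst_add, Prod.snd_add, map_add, mul_add, add_mul]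
        abel
      map_smul' := fun r t => by
        simp only [Prod.smul_fst, Prod.smul_snd, hB, smul_add, mul_smul_comm, smul_mul_assoc,
          RingHom.id_apply, add_mul] }
  refine Module.Finite.of_surjective g (fun l => ?_)
  obtain ⟨b, c, b', c', rfl⟩ := exists_eq_add_mul_sigmaLam l
  exact ⟨(b, c, b', c'), rfl⟩

/-- An additive map of `Λ`-modules that commutes with `B`, `z` and `σ` is `Λ`-linear. -/
lemma map_smul_of_commutes {M N : Type*} [AddCommGroup M] [Module (Lam R B f) M] [AddCommGroup N]
    [Module (Lam R B f) N] (g : M →+ N)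
    (hB : ∀ (b : B) m, g (inclB R B f b • m) = inclB R B f b • g m)
    (hz : ∀ m, g (zLam R B f • m) = zLam R B f • g m)
    (hσ : ∀ m, g (sigmaLam R B f • m) = sigmaLam R B f • g m) (l : Lam R B f) (m : M) :
    g (l • m) = l • g m := by
  obtain ⟨b, c, b', c', rfl⟩ := exists_eq_add_mul_sigmaLam l
  simp only [add_smul, mul_smul, map_add, hB, hz, hσ]

end SkewGroupRing

section EvenOdd

variable (R : Type u) [CommRing R] (B : Type u) [Ring B] [Algebra R B] (f : R)
  (M : Type u) [AddCommGroup M] [Module (Lam R B f) M]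

/-- The even part `(1-ε)M` of a `Λ`-module, on which `σ` is the identity. -/
def Even : AddSubgroup M where
  carrier := {m | sigmaLam R B f • m = m}
  zero_mem' := smul_zero _
  add_mem' ha hb := (smul_add _ _ _).trans (congrArg₂ _ ha hb)
  neg_mem' ha := (smul_neg _ _).trans (congrArg _ ha)

/-- The odd part `εM` of a `Λ`-module, on which `σ` is `-1`. -/
def Odd : AddSubgroup M where
  carrier := {m | sigmaLam R B f • m = -m}
  zero_mem' := (smul_zero _).trans neg_zero.symm
  add_mem' ha hb := (smul_add _ _ _).trans ((congrArg₂ _ ha hb).trans (neg_add _ _).symm)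
  neg_mem' ha := (smul_neg _ _).trans (congrArg _ ha)

variable {R B f M}

lemma mem_even {m : M} : m ∈ Even R B f M ↔ sigmaLam R B f • m = m := Iff.rfl

lemma mem_odd {m : M} : m ∈ Odd R B f M ↔ sigmaLam R B f • m = -m := Iff.rfl

lemma inclB_smul_mem_even (b : B) {m : M} (hm : m ∈ Even R B f M) :
    inclB R B f b • m ∈ Even R B f M := by
  rw [mem_even, ← mul_smul, sigmaLam_mul_inclB, mul_smul, mem_even.1 hm]

lemma inclB_smul_mem_odd (b : B) {m : M} (hm : m ∈ Odd R B f M) :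
    inclB R B f b • m ∈ Odd R B f M := by
  rw [mem_odd, ← mul_smul, sigmaLam_mul_inclB, mul_smul, mem_odd.1 hm, smul_neg]

lemma zLam_smul_mem_odd {m : M} (hm : m ∈ Even R B f M) : zLam R B f • m ∈ Odd R B f M := by
  rw [mem_odd, ← mul_smul, sigmaLam_mul_zLam, neg_smul, mul_smul, mem_even.1 hm]

lemma zLam_smul_mem_even {m : M} (hm : m ∈ Odd R B f M) : zLam R B f • m ∈ Even R B f M := by
  rw [mem_even, ← mul_smul, sigmaLam_mul_zLam, neg_smul, mul_smul, mem_odd.1 hm, smul_neg, neg_neg]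

instance : Module B (Even R B f M) where
  smul b m := ⟨inclB R B f b • m.1, inclB_smul_mem_even b m.2⟩
  one_smul m := Subtype.ext (by change inclB R B f 1 • m.1 = m.1; rw [map_one, one_smul])
  mul_smul b c m := Subtype.ext (by
    change inclB R B f (b * c) • m.1 = inclB R B f b • inclB R B f c • m.1
    rw [map_mul, mul_smul])
  smul_zero b := Subtype.ext (smul_zero _)
  smul_add b m n := Subtype.ext (smul_add _ _ _)
  add_smul b c m := Subtype.ext (by
    change inclB R B f (b + c) • m.1 = inclB R B f b • m.1 + inclB R B f c • m.1
    rw [map_add, add_smul])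
  zero_smul m := Subtype.ext (by change inclB R B f 0 • m.1 = 0; rw [map_zero, zero_smul])

instance : Module B (Odd R B f M) where
  smul b m := ⟨inclB R B f b • m.1, inclB_smul_mem_odd b m.2⟩
  one_smul m := Subtype.ext (by change inclB R B f 1 • m.1 = m.1; rw [map_one, one_smul])
  mul_smul b c m := Subtype.ext (by
    change inclB R B f (b * c) • m.1 = inclB R B f b • inclB R B f c • m.1
    rw [map_mul, mul_smul])
  smul_zero b := Subtype.ext (smul_zero _)
  smul_add b m n := Subtype.ext (smul_add _ _ _)
  add_smul b c m := Subtype.ext (by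
    change inclB R B f (b + c) • m.1 = inclB R B f b • m.1 + inclB R B f c • m.1
    rw [map_add, add_smul])
  zero_smul m := Subtype.ext (by change inclB R B f 0 • m.1 = 0; rw [map_zero, zero_smul])

instance : Module R (Even R B f M) := Module.compHom _ (algebraMap R B)

instance : Module R (Odd R B f M) := Module.compHom _ (algebraMap R B)

instance : IsScalarTower R B (Even R B f M) := .of_algebraMap_smul fun _ _ => rfl

instance : IsScalarTower R B (Odd R B f M) := .of_algebraMap_smul fun _ _ => rfl

variable (R B f M) in
/-- Multiplication by `z` from the even to the odd part. -/
def zEven : Even R B f M →ₗ[B] Odd R B f M where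
  toFun m := ⟨zLam R B f • m.1, zLam_smul_mem_odd m.2⟩
  map_add' m n := Subtype.ext (smul_add _ _ _)
  map_smul' b m := Subtype.ext (by
    change zLam R B f • inclB R B f b • m.1 = inclB R B f b • zLam R B f • m.1
    rw [← mul_smul, zLam_mul_inclB, mul_smul])

variable (R B f M) in
/-- Multiplication by `z` from the odd to the even part. -/
def zOdd : Odd R B f M →ₗ[B] Even R B f M where
  toFun m := ⟨zLam R B f • m.1, zLam_smul_mem_even m.2⟩
  map_add' m n := Subtype.ext (smul_add _ _ _)
  map_smul' b m := Subtype.ext (by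
    change zLam R B f • inclB R B f b • m.1 = inclB R B f b • zLam R B f • m.1
    rw [← mul_smul, zLam_mul_inclB, mul_smul])

lemma zOdd_zEven (m : Even R B f M) : zOdd R B f M (zEven R B f M m) = f • m :=
  Subtype.ext (by
    change zLam R B f • zLam R B f • m.1 = inclB R B f (algebraMap R B f) • m.1
    rw [← mul_smul, zLam_mul_zLam])

lemma zEven_zOdd (m : Odd R B f M) : zEven R B f M (zOdd R B f M m) = f • m :=
  Subtype.ext (by
    change zLam R B f • zLam R B f • m.1 = inclB R B f (algebraMap R B f) • m.1
    rw [← mul_smul, zLam_mul_zLam])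

lemma inclB_half_smul_two (h2 : IsUnit (2 : R)) (m : M) :
    inclB R B f (algebraMap R B (Ring.inverse 2)) • (m + m) = m := by
  rw [← two_smul (Lam R B f) m, ← mul_smul, inclB_algebraMap,
    ← map_ofNat (algebraMap R (Lam R B f)) 2,
    ← map_mul, Ring.inverse_mul_cancel _ h2, map_one, one_smul]

variable (R B f M) in
/-- As `2` is invertible, a `Λ`-module is the direct sum of its even and its odd part. -/
def evenOddEquiv (h2 : IsUnit (2 : R)) : M ≃+ Even R B f M × Odd R B f M where
  toFun m :=
    ⟨⟨inclB R B f (algebraMap R B (Ring.inverse 2)) • (m + sigmaLam R B f • m),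
      inclB_smul_mem_even _ (by
        rw [mem_even, smul_add, ← mul_smul, sigmaLam_mul_sigmaLam, one_smul, add_comm])⟩,
    ⟨inclB R B f (algebraMap R B (Ring.inverse 2)) • (m - sigmaLam R B f • m),
      inclB_smul_mem_odd _ (by
        rw [mem_odd, smul_sub, ← mul_smul, sigmaLam_mul_sigmaLam, one_smul, neg_sub])⟩⟩
  invFun p := p.1 + p.2
  left_inv m := by
    change inclB R B f _ • (m + sigmaLam R B f • m) + inclB R B f _ • (m - sigmaLam R B f • m) = m
    rw [← smul_add, add_add_sub_cancel, inclB_half_smul_two h2]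
  right_inv p := by
    have h1 := mem_even.1 p.1.2
    have h2' := mem_odd.1 p.2.2
    refine Prod.ext (Subtype.ext ?_) (Subtype.ext ?_)
    · change inclB R B f _ • (((p.1 : M) + p.2) + sigmaLam R B f • ((p.1 : M) + p.2)) = p.1
      rw [smul_add (sigmaLam R B f), h1, h2', add_add_add_comm, add_neg_cancel, add_zero,
        inclB_half_smul_two h2]
    · change inclB R B f _ • (((p.1 : M) + p.2) - sigmaLam R B f • ((p.1 : M) + p.2)) = p.2
      rw [smul_add (sigmaLam R B f), h1, h2', add_sub_add_comm, sub_self, zero_add, sub_neg_eq_add,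
        inclB_half_smul_two h2]
  map_add' m n := by
    refine Prod.ext (Subtype.ext ?_) (Subtype.ext ?_)
    · change inclB R B f _ • _ = inclB R B f _ • _ + inclB R B f _ • _
      rw [← smul_add, smul_add (sigmaLam R B f)]
      congr 1
      abel
    · change inclB R B f _ • _ = inclB R B f _ • _ + inclB R B f _ • _
      rw [← smul_add, smul_add (sigmaLam R B f)]
      congr 1
      abel

lemma evenOddEquiv_symm_apply (h2 : IsUnit (2 : R)) (p : Even R B f M × Odd R B f M) :
    (evenOddEquiv R B f M h2).symm p = p.1 + p.2 := rfl

lemma eq_zero_of_mem_even_of_mem_odd (h2 : IsUnit (2 : R)) {m : M} (h : m ∈ Even R B f M)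
    (h' : m ∈ Odd R B f M) : m = 0 := by
  have : m + m = 0 := by
    nth_rewrite 1 [← mem_even.1 h]
    rw [mem_odd.1 h', neg_add_cancel]
  rw [← inclB_half_smul_two (B := B) (f := f) h2 m, this, smul_zero]

/-- The decomposition of a `Λ`-module into even and odd part, as `B`-modules. -/
def evenOddLinearEquiv [Module B M] (hM : ∀ (b : B) (m : M), b • m = inclB R B f b • m)
    (h2 : IsUnit (2 : R)) : M ≃ₗ[B] Even R B f M × Odd R B f M :=
  ((evenOddEquiv R B f M h2).symm.toLinearEquiv (fun b p => by
    rw [evenOddEquiv_symm_apply, evenOddEquiv_symm_apply, hM, smul_add]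
    rfl)).symm

variable {N : Type u} [AddCommGroup N] [Module (Lam R B f) N]

/-- A `Λ`-linear map restricted to the even parts. -/
def evenMap (g : M →ₗ[Lam R B f] N) : Even R B f M →ₗ[B] Even R B f N where
  toFun m := ⟨g m, by rw [mem_even, ← map_smul, mem_even.1 m.2]⟩
  map_add' m n := Subtype.ext (map_add g _ _)
  map_smul' b m := Subtype.ext (map_smul g _ _)

/-- A `Λ`-linear map restricted to the odd parts. -/
def oddMap (g : M →ₗ[Lam R B f] N) : Odd R B f M →ₗ[B] Odd R B f N where
  toFun m := ⟨g m, by rw [mem_odd, ← map_smul, mem_odd.1 m.2, map_neg]⟩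
  map_add' m n := Subtype.ext (map_add g _ _)
  map_smul' b m := Subtype.ext (map_smul g _ _)

@[simp] lemma coe_oddMap (g : M →ₗ[Lam R B f] N) (m : Odd R B f M) :
    (oddMap g m : N) = g m := rfl

/-- The `Λ`-linear map given by a pair of `B`-linear maps of the even and odd parts that commute
with `z`. -/
def homOfEvenOdd (h2 : IsUnit (2 : R)) (g₀ : Even R B f M →ₗ[B] Even R B f N)
    (g₁ : Odd R B f M →ₗ[B] Odd R B f N)
    (h₀ : ∀ m, g₁ (zEven R B f M m) = zEven R B f N (g₀ m))
    (h₁ : ∀ m, g₀ (zOdd R B f M m) = zOdd R B f N (g₁ m)) : M →ₗ[Lam R B f] N :=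
  let g : M →+ N := (evenOddEquiv R B f N h2).symm.toAddMonoidHom.comp
    ((AddMonoidHom.prodMap g₀.toAddMonoidHom g₁.toAddMonoidHom).comp
      (evenOddEquiv R B f M h2).toAddMonoidHom)
  have hg : ∀ p, g ((evenOddEquiv R B f M h2).symm p) = (g₀ p.1 : N) + (g₁ p.2 : N) := fun p => by
    change (g₀ ((evenOddEquiv R B f M h2) ((evenOddEquiv R B f M h2).symm p)).1 : N) +
      (g₁ ((evenOddEquiv R B f M h2) ((evenOddEquiv R B f M h2).symm p)).2 : N) = _
    rw [AddEquiv.apply_symm_apply]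
  { g with
    map_smul' := by
      refine map_smul_of_commutes g (fun b m => ?_) (fun m => ?_) (fun m => ?_)
      · obtain ⟨p, rfl⟩ := (evenOddEquiv R B f M h2).symm.surjective m
        have : inclB R B f b • (evenOddEquiv R B f M h2).symm p =
            (evenOddEquiv R B f M h2).symm (b • p) := by
          rw [evenOddEquiv_symm_apply, smul_add]; rfl
        rw [this, hg, hg, smul_add, Prod.smul_fst, Prod.smul_snd, map_smul, map_smul]
        rfl
      · obtain ⟨p, rfl⟩ := (evenOddEquiv R B f M h2).symm.surjective m
        have : zLam R B f • (evenOddEquiv R B f M h2).symm p =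
            (evenOddEquiv R B f M h2).symm (zOdd R B f M p.2, zEven R B f M p.1) := by
          rw [evenOddEquiv_symm_apply, smul_add, add_comm]; rfl
        rw [this, hg, hg, smul_add, h₀, h₁, add_comm]
        rfl
      · obtain ⟨p, rfl⟩ := (evenOddEquiv R B f M h2).symm.surjective m
        have : sigmaLam R B f • (evenOddEquiv R B f M h2).symm p =
            (evenOddEquiv R B f M h2).symm (p.1, -p.2) := by
          rw [evenOddEquiv_symm_apply, smul_add, mem_even.1 p.1.2, mem_odd.1 p.2.2]; rfl
        rw [this, hg, hg, smul_add, mem_even.1 (g₀ p.1).2, mem_odd.1 (g₁ p.2).2, map_neg]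
        rfl }

lemma homOfEvenOdd_add {h2 : IsUnit (2 : R)} {g₀ : Even R B f M →ₗ[B] Even R B f N}
    {g₁ : Odd R B f M →ₗ[B] Odd R B f N} (h₀ h₁) (m₀ : Even R B f M) (m₁ : Odd R B f M) :
    homOfEvenOdd h2 g₀ g₁ h₀ h₁ (m₀ + m₁) = g₀ m₀ + g₁ m₁ := by
  change (g₀ ((evenOddEquiv R B f M h2) ((evenOddEquiv R B f M h2).symm (m₀, m₁))).1 : N) +
      (g₁ ((evenOddEquiv R B f M h2) ((evenOddEquiv R B f M h2).symm (m₀, m₁))).2 : N) = _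
  rw [AddEquiv.apply_symm_apply]

end EvenOdd

/-! ### Matrix factorizations -/

section MatrixFactorization

variable {R : Type u} [CommRing R] {B : Type u} [Ring B] [Algebra R B] {f : R}
  {M₀ M₁ : Type u} [AddCommGroup M₀] [Module R M₀] [Module B M₀] [IsScalarTower R B M₀]
  [AddCommGroup M₁] [Module R M₁] [Module B M₁] [IsScalarTower R B M₁]

/-- A matrix factorization of `f` over `B`: two `B`-linear maps whose composites in both orders
are multiplication by `f`. -/
structure MatrixFactorization (f : R) (M₀ M₁ : Type u) [AddCommGroup M₀] [Module R M₀] [Module B M₀]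
    [AddCommGroup M₁] [Module R M₁] [Module B M₁] where
  φ : M₀ →ₗ[B] M₁
  ψ : M₁ →ₗ[B] M₀
  ψ_φ : ∀ m, ψ (φ m) = f • m
  φ_ψ : ∀ m, φ (ψ m) = f • m

namespace MatrixFactorization

variable (X : MatrixFactorization (B := B) f M₀ M₁)

/-- The action of `z` on `M₀ × M₁`. -/
def zEnd : Module.End R (M₀ × M₁) where
  toFun m := (X.ψ m.2, X.φ m.1)
  map_add' m n := Prod.ext (map_add _ _ _) (map_add _ _ _)
  map_smul' r m := Prod.ext
    (by change X.ψ (r • m.2) = r • X.ψ m.2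
        rw [← algebraMap_smul B r m.2, map_smul, algebraMap_smul])
    (by change X.φ (r • m.1) = r • X.φ m.1
        rw [← algebraMap_smul B r m.1, map_smul, algebraMap_smul])

/-- The action of `σ` on `M₀ × M₁`. -/
def sigmaEnd (R M₀ M₁ : Type u) [CommRing R] [AddCommGroup M₀] [Module R M₀]
    [AddCommGroup M₁] [Module R M₁] : Module.End R (M₀ × M₁) where
  toFun m := (m.1, -m.2)
  map_add' _ _ := Prod.ext rfl (neg_add _ _)
  map_smul' _ _ := Prod.ext rfl (smul_neg _ _).symm

lemma sigmaEnd_mul_sigmaEnd : sigmaEnd R M₀ M₁ * sigmaEnd R M₀ M₁ = 1 :=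
  LinearMap.ext fun _ => Prod.ext rfl (neg_neg _)

/-- The action of `R[√f]` on `M₀ × M₁`. -/
def sqrtBaseEnd : SqrtBase R f →ₐ[R] Module.End R (M₀ × M₁) :=
  QuadraticAlgebra.lift ⟨X.zEnd, LinearMap.ext fun m => by
    rw [zero_smul, add_zero]
    exact Prod.ext (X.ψ_φ _) (X.φ_ψ _)⟩

lemma commute_sqrtBaseEnd (a : SqrtBase R f) (b : B) :
    Commute (X.sqrtBaseEnd a) (Algebra.lsmul R R (M₀ × M₁) b) :=
  LinearMap.ext fun m => by
    change a.re • b • m + a.im • X.zEnd (b • m) = b • (a.re • m + a.im • X.zEnd m)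
    have h : X.zEnd (b • m) = b • X.zEnd m := Prod.ext (map_smul X.ψ b _) (map_smul X.φ b _)
    have hc : ∀ (r : R) (n : M₀ × M₁), r • b • n = b • r • n := fun r n => by
      rw [← algebraMap_smul B r (b • n), ← algebraMap_smul B r n, ← mul_smul, ← mul_smul,
        Algebra.commutes]
    rw [h, smul_add, hc, hc]

/-- The action of `B[√f]` on `M₀ × M₁`. -/
def doubleCoverEnd : DoubleCover R B f →ₐ[R] Module.End R (M₀ × M₁) :=
  Algebra.TensorProduct.lift X.sqrtBaseEnd (Algebra.lsmul R R (M₀ × M₁)) X.commute_sqrtBaseEnd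

lemma doubleCoverEnd_one_tmul (b : B) (m : M₀ × M₁) :
    X.doubleCoverEnd (1 ⊗ₜ[R] b) m = b • m := by
  rw [doubleCoverEnd, Algebra.TensorProduct.lift_tmul, map_one, one_mul]
  rfl

lemma doubleCoverEnd_omega_tmul (b : B) (m : M₀ × M₁) :
    X.doubleCoverEnd (QuadraticAlgebra.omega ⊗ₜ[R] b) m = X.zEnd (b • m) := by
  rw [doubleCoverEnd, Algebra.TensorProduct.lift_tmul]
  change (0 : R) • b • m + (1 : R) • X.zEnd (b • m) = X.zEnd (b • m)
  rw [zero_smul, one_smul, zero_add]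

/-- The action of `G_f` on `M₀ × M₁`. -/
def gfEnd (R M₀ M₁ : Type u) [CommRing R] [AddCommGroup M₀] [Module R M₀]
    [AddCommGroup M₁] [Module R M₁] : Gf →* Module.End R (M₀ × M₁) where
  toFun g := if g = 1 then 1 else sigmaEnd R M₀ M₁
  map_one' := if_pos rfl
  map_mul' g h := by
    have key : ∀ g h : Gf, g ≠ 1 → h ≠ 1 → g * h = 1 := by decide
    by_cases hg : g = 1
    · subst hg; simp
    · by_cases hh : h = 1
      · subst hh; simp
      · simp [hg, hh, key g h hg hh, sigmaEnd_mul_sigmaEnd]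

lemma gfEnd_genGf : gfEnd R M₀ M₁ genGf = sigmaEnd R M₀ M₁ :=
  if_neg (t := (1 : Module.End R (M₀ × M₁))) (by decide : ¬ genGf = 1)

/-- The action of `Λ` on `M₀ × M₁`. -/
def lamEnd : Lam R B f →+* Module.End R (M₀ × M₁) :=
  SkewMonoidAlgebra.liftNCRingHom X.doubleCoverEnd.toRingHom (gfEnd R M₀ M₁) (by
    intro x g
    have hg : g = 1 ∨ g = genGf := by revert g; decide
    rcases hg with rfl | rfl
    · rw [one_smul, map_one, mul_one, one_mul]
    · rw [gfEnd_genGf, genGf_smul]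
      obtain ⟨b, c, rfl⟩ := exists_eq_tmul_add_tmul x
      have hω : sigmaBase R f QuadraticAlgebra.omega = -QuadraticAlgebra.omega := by
        simp [sigmaBase]
      have hs : sigma R B f (1 ⊗ₜ[R] b + QuadraticAlgebra.omega ⊗ₜ[R] c) =
          1 ⊗ₜ[R] b - QuadraticAlgebra.omega ⊗ₜ[R] c := by
        rw [sigma, map_add, Algebra.TensorProduct.map_tmul, Algebra.TensorProduct.map_tmul,
          map_one, hω, TensorProduct.neg_tmul, sub_eq_add_neg]
        rfl
      rw [hs]
      refine LinearMap.ext fun m => ?_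
      change X.doubleCoverEnd (1 ⊗ₜ[R] b - QuadraticAlgebra.omega ⊗ₜ[R] c) (sigmaEnd R M₀ M₁ m) =
        sigmaEnd R M₀ M₁ (X.doubleCoverEnd (1 ⊗ₜ[R] b + QuadraticAlgebra.omega ⊗ₜ[R] c) m)
      rw [map_sub, map_add, LinearMap.sub_apply, LinearMap.add_apply, doubleCoverEnd_one_tmul,
        doubleCoverEnd_one_tmul, doubleCoverEnd_omega_tmul, doubleCoverEnd_omega_tmul]
      refine Prod.ext ?_ ?_
      · change b • m.1 - X.ψ (c • (-m.2)) = b • m.1 + X.ψ (c • m.2)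
        rw [smul_neg, map_neg, sub_neg_eq_add]
      · change b • (-m.2) - X.φ (c • m.1) = -(b • m.2 + X.φ (c • m.1))
        rw [smul_neg, neg_add, sub_eq_add_neg])

lemma lamEnd_single (g : Gf) (x : DoubleCover R B f) :
    X.lamEnd (single R B f g x) = X.doubleCoverEnd x * gfEnd R M₀ M₁ g :=
  SkewMonoidAlgebra.liftNC_single _ _ _ _

lemma lamEnd_zLam : X.lamEnd (zLam R B f) = X.zEnd := by
  refine LinearMap.ext fun m => ?_
  rw [zLam, lamEnd_single, map_one, mul_one, doubleCoverEnd_omega_tmul, one_smul]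

lemma lamEnd_inclB (b : B) (m) : X.lamEnd (inclB R B f b) m = b • m := by
  rw [inclB_apply, lamEnd_single, map_one, mul_one, doubleCoverEnd_one_tmul]

lemma lamEnd_sigmaLam : X.lamEnd (sigmaLam R B f) = sigmaEnd R M₀ M₁ := by
  rw [sigmaLam, lamEnd_single, map_one, one_mul, gfEnd_genGf]

/-- The `Λ`-module `M₀ ⊕ M₁` of a matrix factorization; `z` acts by `φ` and `ψ`, and `σ` by `1` on
`M₀` and by `-1` on `M₁`. -/
@[nolint unusedArguments]
def Total (_ : MatrixFactorization (B := B) f M₀ M₁) : Type u := M₀ × M₁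

/-- The element `(m, n)` of `M₀ ⊕ M₁`. -/
def pair (m : M₀) (n : M₁) : X.Total := (m, n)

instance : AddCommGroup X.Total := inferInstanceAs (AddCommGroup (M₀ × M₁))

instance : Module (Lam R B f) X.Total :=
  letI : Module (Module.End R (M₀ × M₁)) X.Total :=
    inferInstanceAs (Module (Module.End R (M₀ × M₁)) (M₀ × M₁))
  Module.compHom X.Total X.lamEnd

@[simp] lemma zLam_smul_pair (m : M₀) (n : M₁) :
    zLam R B f • X.pair m n = X.pair (X.ψ n) (X.φ m) :=
  congrArg (fun e : Module.End R (M₀ × M₁) => e (m, n)) X.lamEnd_zLam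

@[simp] lemma sigmaLam_smul_pair (m : M₀) (n : M₁) :
    sigmaLam R B f • X.pair m n = X.pair m (-n) :=
  congrArg (fun e : Module.End R (M₀ × M₁) => e (m, n)) X.lamEnd_sigmaLam

@[simp] lemma inclB_smul_pair (b : B) (m : M₀) (n : M₁) :
    inclB R B f b • X.pair m n = X.pair (b • m) (b • n) :=
  X.lamEnd_inclB b (m, n)

lemma eq_zero_of_eq_neg (h2 : IsUnit (2 : R)) {m : M₀} (h : -m = m) : m = 0 := by
  have h' : (2 : R) • m = 0 := by
    rw [two_smul]
    nth_rewrite 1 [← h]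
    exact neg_add_cancel m
  exact (h2.smul_eq_zero).1 h'

/-- `M₀` is the even part of `M₀ ⊕ M₁`. -/
def evenEquiv (h2 : IsUnit (2 : R)) : M₀ ≃ₗ[B] Even R B f X.Total where
  toFun m := ⟨X.pair m 0, by rw [mem_even, sigmaLam_smul_pair, neg_zero]⟩
  map_add' m n := Subtype.ext (Prod.ext rfl (add_zero _).symm)
  map_smul' b m := Subtype.ext (by
    change X.pair (b • m) 0 = inclB R B f b • X.pair m 0
    rw [inclB_smul_pair, smul_zero])
  invFun m := (show M₀ × M₁ from m.1).1
  left_inv _ := rfl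
  right_inv m := Subtype.ext (Prod.ext rfl
    (eq_zero_of_eq_neg h2 (congrArg Prod.snd ((X.sigmaLam_smul_pair (show M₀ × M₁ from m.1).1
      (show M₀ × M₁ from m.1).2).symm.trans (mem_even.1 m.2)))).symm)

/-- `M₁` is the odd part of `M₀ ⊕ M₁`. -/
def oddEquiv (h2 : IsUnit (2 : R)) : M₁ ≃ₗ[B] Odd R B f X.Total where
  toFun m := ⟨X.pair 0 m, by
    rw [mem_odd, sigmaLam_smul_pair]; exact Prod.ext neg_zero.symm rfl⟩
  map_add' m n := Subtype.ext (Prod.ext (add_zero _).symm rfl)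
  map_smul' b m := Subtype.ext (by
    change X.pair 0 (b • m) = inclB R B f b • X.pair 0 m
    rw [inclB_smul_pair, smul_zero])
  invFun m := (show M₀ × M₁ from m.1).2
  left_inv _ := rfl
  right_inv m := Subtype.ext (Prod.ext
    (eq_zero_of_eq_neg h2 (congrArg Prod.fst ((X.sigmaLam_smul_pair (show M₀ × M₁ from m.1).1
      (show M₀ × M₁ from m.1).2).symm.trans (mem_odd.1 m.2))).symm).symm rfl)

lemma oddEquiv_φ (h2 : IsUnit (2 : R)) (m : M₀) :
    X.oddEquiv h2 (X.φ m) = zEven R B f X.Total (X.evenEquiv h2 m) :=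
  Subtype.ext (by
    change X.pair 0 (X.φ m) = zLam R B f • X.pair m 0
    rw [zLam_smul_pair, map_zero])

end MatrixFactorization

end MatrixFactorization

/-! ### The stable homomorphism group as a cokernel -/

section StableHom

variable {R : Type u} [CommRing R] {B : Type u} [Ring B] [Algebra R B] {f : R}
  {M : Type u} [AddCommGroup M] [Module (Lam R B f) M]

lemma two_smul_eps (h2 : IsUnit (2 : R)) : (2 : R) • eps R B f = 1 - sigmaLam R B f := by
  rw [eps, smul_smul, Ring.mul_inverse_cancel _ h2, one_smul]

lemma sigmaLam_eq (h2 : IsUnit (2 : R)) : sigmaLam R B f = 1 - (eps R B f + eps R B f) := by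
  rw [← two_smul R, two_smul_eps h2, sub_sub_cancel]

lemma eps_mul_sigmaLam : eps R B f * sigmaLam R B f = -eps R B f := by
  rw [eps, smul_mul_assoc, sub_mul, one_mul, sigmaLam_mul_sigmaLam, ← smul_neg, neg_sub]

lemma sigmaLam_mul_eps : sigmaLam R B f * eps R B f = -eps R B f := by
  rw [eps, mul_smul_comm, mul_sub, mul_one, sigmaLam_mul_sigmaLam, ← smul_neg, neg_sub]

lemma eps_mul_eps (h2 : IsUnit (2 : R)) : eps R B f * eps R B f = eps R B f := by
  nth_rewrite 2 [eps]
  rw [mul_smul_comm, mul_sub, mul_one, eps_mul_sigmaLam, sub_neg_eq_add, ← two_smul R, smul_smul,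
    Ring.inverse_mul_cancel _ h2, one_smul]

lemma eps_smul_of_mem_odd (h2 : IsUnit (2 : R)) {m : M} (hm : m ∈ Odd R B f M) :
    eps R B f • m = m := by
  have h : eps R B f = algebraMap R (Lam R B f) (Ring.inverse 2) * (1 - sigmaLam R B f) :=
    Algebra.smul_def _ _
  rw [h, mul_smul, sub_smul, one_smul, mem_odd.1 hm, sub_neg_eq_add, ← inclB_algebraMap,
    inclB_half_smul_two h2]

lemma eps_smul_of_mem_even {m : M} (hm : m ∈ Even R B f M) : eps R B f • m = 0 := by
  have h : eps R B f = algebraMap R (Lam R B f) (Ring.inverse 2) * (1 - sigmaLam R B f) :=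
    Algebra.smul_def _ _
  rw [h, mul_smul, sub_smul, one_smul, mem_even.1 hm, sub_self, smul_zero]

variable (R B f) in
/-- `ε` as an element of `Λε`. -/
def epsMem : LamEps R B f := ⟨eps R B f, Submodule.mem_span_singleton_self _⟩

variable (R B f) in
/-- `1 - ε` as an element of `Λ(1-ε)`. -/
def oneSubEpsMem : LamOneSubEps R B f := ⟨1 - eps R B f, Submodule.mem_span_singleton_self _⟩

lemma epsMem_mem_odd : epsMem R B f ∈ Odd R B f (LamEps R B f) :=
  Subtype.ext sigmaLam_mul_eps

lemma oneSubEpsMem_mem_even (h2 : IsUnit (2 : R)) :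
    oneSubEpsMem R B f ∈ Even R B f (LamOneSubEps R B f) := by
  refine Subtype.ext ?_
  change sigmaLam R B f * (1 - eps R B f) = 1 - eps R B f
  rw [mul_sub, mul_one, sigmaLam_mul_eps, sub_neg_eq_add]
  nth_rewrite 1 [sigmaLam_eq h2]
  abel

lemma exists_eq_smul_epsMem (x : LamEps R B f) : ∃ c : Lam R B f, x = c • epsMem R B f := by
  obtain ⟨c, hc⟩ := Submodule.mem_span_singleton.1 x.2
  exact ⟨c, Subtype.ext hc.symm⟩

lemma exists_eq_smul_oneSubEpsMem (x : LamOneSubEps R B f) :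
    ∃ c : Lam R B f, x = c • oneSubEpsMem R B f := by
  obtain ⟨c, hc⟩ := Submodule.mem_span_singleton.1 x.2
  exact ⟨c, Subtype.ext hc.symm⟩

/-- Homomorphisms from `Λε` to `M` are the odd elements of `M`. -/
def homLamEpsEquiv (h2 : IsUnit (2 : R)) : (LamEps R B f →ₗ[Lam R B f] M) ≃+ Odd R B f M where
  toFun φ := oddMap φ ⟨epsMem R B f, epsMem_mem_odd⟩
  invFun m := LinearMap.toSpanSingleton (Lam R B f) M m ∘ₗ (LamEps R B f).subtype
  left_inv φ := by
    ext x
    obtain ⟨c, rfl⟩ := exists_eq_smul_epsMem x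
    change (c * eps R B f) • φ (epsMem R B f) = φ (c • epsMem R B f)
    rw [mul_smul, ← map_smul, ← map_smul]
    congr 2
    exact Subtype.ext (eps_mul_eps h2)
  right_inv m := Subtype.ext (eps_smul_of_mem_odd h2 m.2)
  map_add' _ _ := rfl

/-- The homomorphism from `Λ(1-ε)` to `M` that takes `1-ε` to a given even element. -/
def homOfEven (m : Even R B f M) : LamOneSubEps R B f →ₗ[Lam R B f] M :=
  LinearMap.toSpanSingleton (Lam R B f) M m ∘ₗ (LamOneSubEps R B f).subtype

lemma homOfEven_oneSubEpsMem (m : Even R B f M) :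
    homOfEven m (oneSubEpsMem R B f) = m := by
  change (1 - eps R B f) • (m : M) = m
  rw [sub_smul, one_smul, eps_smul_of_mem_even m.2, sub_zero]

/-- The odd part of `Λ(1-ε)` is `zB(1-ε)`, so that its image under a homomorphism to `M` lies in
`z` times the even part of `M`. -/
lemma oddMap_mem_range_zEven (h2 : IsUnit (2 : R)) (b : LamOneSubEps R B f →ₗ[Lam R B f] M)
    (w : Odd R B f (LamOneSubEps R B f)) :
    oddMap b w ∈ LinearMap.range (zEven R B f M) := by
  have heven := oneSubEpsMem_mem_even (B := B) (f := f) h2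
  obtain ⟨l, hl⟩ := exists_eq_smul_oneSubEpsMem w.1
  obtain ⟨b₁, b₂, b₃, b₄, rfl⟩ := exists_eq_add_mul_sigmaLam l
  set e := oneSubEpsMem R B f
  have hw : (w : LamOneSubEps R B f) =
      inclB R B f (b₁ + b₃) • e + zLam R B f • inclB R B f (b₂ + b₄) • e := by
    rw [hl, add_smul, mul_smul, mem_even.1 heven, map_add, map_add]
    simp only [add_smul, mul_smul, smul_add]
    abel
  have h0 : inclB R B f (b₁ + b₃) • e = 0 := by
    refine eq_zero_of_mem_even_of_mem_odd h2 (inclB_smul_mem_even _ heven) ?_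
    rw [eq_sub_of_add_eq hw.symm]
    exact sub_mem w.2 (zLam_smul_mem_odd (inclB_smul_mem_even _ heven))
  rw [h0, zero_add] at hw
  refine ⟨evenMap b ⟨inclB R B f (b₂ + b₄) • e, inclB_smul_mem_even _ heven⟩, Subtype.ext ?_⟩
  change zLam R B f • b (inclB R B f (b₂ + b₄) • e) = b w.1
  rw [hw]
  exact (map_smul b (zLam R B f) _).symm

variable (R B f) in
/-- Right multiplication by `z` from `Λε` to `Λ(1-ε)`. -/
def rightMulZ (h2 : IsUnit (2 : R)) : LamEps R B f →ₗ[Lam R B f] LamOneSubEps R B f where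
  toFun x := ⟨x.1 * zLam R B f, by
    obtain ⟨c, hc⟩ := Submodule.mem_span_singleton.1 x.2
    refine Submodule.mem_span_singleton.2 ⟨c * zLam R B f, ?_⟩
    rw [← hc, smul_eq_mul, smul_eq_mul, mul_assoc, mul_assoc, eps_mul_zLam R B f h2]⟩
  map_add' _ _ := Subtype.ext (add_mul _ _ _)
  map_smul' _ _ := Subtype.ext (mul_assoc _ _ _)

/-- A homomorphism `Λε → M` factors through copies of `Λ(1-ε)` if and only if the corresponding odd
element is a multiple of `z`; if it is, one copy suffices. -/
lemma mem_throughIdeal_iff (h2 : IsUnit (2 : R)) (φ : LamEps R B f →ₗ[Lam R B f] M) :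
    φ ∈ throughIdeal (LamOneSubEps R B f) (LamEps R B f) M ↔
      homLamEpsEquiv h2 φ ∈ LinearMap.range (zEven R B f M) := by
  constructor
  · intro h
    induction h using AddSubgroup.closure_induction with
    | mem x hx =>
      obtain ⟨a, b, rfl⟩ := hx
      exact oddMap_mem_range_zEven h2 b (oddMap a ⟨epsMem R B f, epsMem_mem_odd⟩)
    | zero => rw [map_zero]; exact zero_mem _
    | add x y _ _ hx hy => rw [map_add]; exact add_mem hx hy
    | neg x _ hx => rw [map_neg]; exact neg_mem hx
  · rintro ⟨m, hm⟩
    have : φ = homOfEven m ∘ₗ rightMulZ R B f h2 := by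
      rw [← (homLamEpsEquiv h2).symm_apply_apply φ, ← hm]
      ext x
      change x.1 • zLam R B f • (m : M) = (x.1 * zLam R B f) • (m : M)
      rw [mul_smul]
    rw [this]
    exact comp_mem_throughIdeal _ _

variable (R B f M) in
/-- The cokernel of multiplication by `z` from the even to the odd part. -/
abbrev OddCoker := Odd R B f M ⧸ LinearMap.range (zEven R B f M)

variable (R B f M) in
/-- The stable homomorphism group from `Λε` to `M` is the cokernel of `z` from the even to the
odd part of `M`. -/
def stableHomEquiv (h2 : IsUnit (2 : R)) : StableHom R B f M ≃+ OddCoker R B f M :=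
  QuotientAddGroup.congr _ _ (homLamEpsEquiv h2) (by
    ext m
    rw [AddSubgroup.mem_map]
    constructor
    · rintro ⟨φ, hφ, rfl⟩
      exact (mem_throughIdeal_iff h2 φ).1 hφ
    · intro hm
      refine ⟨(homLamEpsEquiv h2).symm m, (mem_throughIdeal_iff h2 _).2 ?_,
        (homLamEpsEquiv h2).apply_symm_apply m⟩
      rw [AddEquiv.apply_symm_apply]
      exact hm)

lemma stableHomEquiv_mk (h2 : IsUnit (2 : R)) (φ : LamEps R B f →ₗ[Lam R B f] M) :
    stableHomEquiv R B f M h2 (QuotientAddGroup.mk φ) =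
      Submodule.Quotient.mk (homLamEpsEquiv h2 φ) := rfl

lemma homLamEpsEquiv_comp_rightMul (h2 : IsUnit (2 : R)) (b : B)
    (φ : LamEps R B f →ₗ[Lam R B f] M) :
    homLamEpsEquiv h2 (φ ∘ₗ rightMul R B f b) = b • homLamEpsEquiv h2 φ := by
  refine Subtype.ext ?_
  change φ (rightMul R B f b (epsMem R B f)) = inclB R B f b • φ (epsMem R B f)
  rw [← map_smul]
  congr 1
  exact Subtype.ext (eps_mul_inclB R B f b)

lemma stableHomEquiv_smul (h2 : IsUnit (2 : R)) (b : B) (x : StableHom R B f M) :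
    stableHomEquiv R B f M h2 ((Ideal.Quotient.mk _ b : HypersurfaceQuotient R B f) • x) =
      b • stableHomEquiv R B f M h2 x := by
  induction x using QuotientAddGroup.induction_on with | H φ => ?_
  rw [mk_smul_mk, stableHomEquiv_mk, stableHomEquiv_mk, homLamEpsEquiv_comp_rightMul]
  rfl

lemma stableHomEquiv_map {N : Type u} [AddCommGroup N] [Module (Lam R B f) N] (h2 : IsUnit (2 : R))
    (g : M →ₗ[Lam R B f] N) (m : Odd R B f M) :
    stableHomEquiv R B f N h2 (stableHomMap R B f g
      ((stableHomEquiv R B f M h2).symm (Submodule.Quotient.mk m))) =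
      Submodule.Quotient.mk (oddMap g m) := by
  obtain ⟨φ, rfl⟩ := (homLamEpsEquiv h2).surjective m
  rw [← stableHomEquiv_mk, AddEquiv.symm_apply_apply]
  rfl

lemma stableHomEquiv_symm_smul (h2 : IsUnit (2 : R)) (b : B)
    (x : OddCoker R B f M) : (stableHomEquiv R B f M h2).symm (b • x) =
      (Ideal.Quotient.mk _ b : HypersurfaceQuotient R B f) •
        (stableHomEquiv R B f M h2).symm x := by
  rw [AddEquiv.symm_apply_eq, stableHomEquiv_smul, AddEquiv.apply_symm_apply]

/-- A homomorphism from `M` to `Λ(1-ε)` defined by a linear form on the odd part of `M`. -/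
def homOfDualOdd (h2 : IsUnit (2 : R)) (c : Odd R B f M →ₗ[B] B) :
    M →ₗ[Lam R B f] LamOneSubEps R B f :=
  homOfEvenOdd h2
    (LinearMap.toSpanSingleton B _ ⟨oneSubEpsMem R B f, oneSubEpsMem_mem_even h2⟩ ∘ₗ c ∘ₗ
      zEven R B f M)
    (LinearMap.toSpanSingleton B _
      (zEven R B f _ ⟨oneSubEpsMem R B f, oneSubEpsMem_mem_even h2⟩) ∘ₗ c)
    (fun m => by
      simp only [LinearMap.comp_apply, LinearMap.toSpanSingleton_apply, map_smul])
    (fun m => by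
      have hc : c (f • m) = algebraMap R B f * c m := map_smul c (algebraMap R B f) m
      simp only [LinearMap.comp_apply, LinearMap.toSpanSingleton_apply, map_smul, zOdd_zEven,
        zEven_zOdd, hc]
      rw [Algebra.commutes, mul_smul, algebraMap_smul])

lemma homOfDualOdd_add (h2 : IsUnit (2 : R)) (c : Odd R B f M →ₗ[B] B) (m₀ : Even R B f M)
    (m₁ : Odd R B f M) : homOfDualOdd h2 c (m₀ + m₁) =
      inclB R B f (c (zEven R B f M m₀)) • oneSubEpsMem R B f +
        inclB R B f (c m₁) • zLam R B f • oneSubEpsMem R B f :=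
  homOfEvenOdd_add _ _ _ _

end StableHom

/-! ### Maximal Cohen-Macaulay modules over `Λ` and `A` -/

section MaximalCohenMacaulay

open IsLocalRing RingTheory.Sequence

lemma isUnit_two (R : Type u) [CommRing R] [IsLocalRing R] [CharZero (ResidueField R)] :
    IsUnit (2 : R) := by
  by_contra h
  have h1 : residue R 2 = 0 := (residue_eq_zero_iff 2).2 ((mem_maximalIdeal 2).2 h)
  rw [map_ofNat] at h1
  exact two_ne_zero h1

lemma projective_restrictScalars {R : Type u} [CommRing R] {B : Type u} [Ring B] [Algebra R B]
    [Module.Free R B] (P : Type u) [AddCommGroup P] [Module R P] [Module B P] [IsScalarTower R B P]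
    [Module.Projective B P] : Module.Projective R P := by
  obtain ⟨s, hs⟩ := Module.projective_def'.1 (inferInstance : Module.Projective B P)
  exact Module.Projective.of_split (M := P →₀ B) (s.restrictScalars R)
    ((Finsupp.linearCombination B id).restrictScalars R)
    (LinearMap.ext fun x => LinearMap.congr_fun hs x)

variable {R : Type u} [CommRing R] [IsRegularLocalRing R] {B : Type u} [Ring B] [Algebra R B]

/-- The Auslander-Buchsbaum bound: over a regular algebra, a finite module with a regular sequence
whose length is the dimension of the base is projective. -/
lemma IsRegularAlgebra.projective_of_isWeaklyRegular (hB : IsRegularAlgebra R B) {N : Type u}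
    [AddCommGroup N] [Module R N] [Module B N] [IsScalarTower R B N] [Module.Finite B N]
    (rs : List R) (hmem : ∀ r ∈ rs, r ∈ maximalIdeal R) (hrs : IsWeaklyRegular N rs)
    (hlen : ringKrullDim R ≤ (rs.length : ℕ)) : Module.Projective B N := by
  have := hB.finite
  have := hB.free
  have := isDomain_of_isRegularLocalRing R
  refine (IsProjective.iff_projective N).2 (projective_iff_hasProjectiveDimensionLT_one.2 ?_)
  exact hasProjectiveDimensionLT_of_isWeaklyRegular rs hmem hrs 0
    (by rwa [hB.globalDimension_eq, zero_add])

/-- A surjection from a projective module to a module with a regular sequence of length one less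
than the dimension of the base has projective kernel. -/
lemma IsRegularAlgebra.projective_ker_of_isWeaklyRegular (hB : IsRegularAlgebra R B) {P N : Type u}
    [AddCommGroup P] [Module B P] [Module.Projective B P]
    [AddCommGroup N] [Module R N] [Module B N] [IsScalarTower R B N] [Module.Finite B N]
    (rs : List R) (hmem : ∀ r ∈ rs, r ∈ maximalIdeal R) (hrs : IsWeaklyRegular N rs)
    (hlen : ringKrullDim R ≤ (1 + rs.length : ℕ)) (p : P →ₗ[B] N) (hp : Function.Surjective p) :
    Module.Projective B (LinearMap.ker p) := by
  have := hB.finite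
  have := hB.free
  have := isDomain_of_isRegularLocalRing R
  refine (IsProjective.iff_projective _).2 (projective_iff_hasProjectiveDimensionLT_one.2 ?_)
  have h3 := hasProjectiveDimensionLT_of_isWeaklyRegular rs hmem hrs 1
    (by rwa [hB.globalDimension_eq])
  have h2 : Projective (ModuleCat.of B P) := (IsProjective.iff_projective P).1 inferInstance
  exact (LinearMap.shortExact_shortComplexKer hp).hasProjectiveDimensionLT_X₁ 1
    (hasProjectiveDimensionLT_of_ge _ 1 _ (by omega)) h3

lemma IsRegularAlgebra.flat (hB : IsRegularAlgebra R B) (P : Type u) [AddCommGroup P] [Module R P]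
    [Module B P] [IsScalarTower R B P] [Module.Projective B P] : Module.Flat R P := by
  have := hB.free
  have := projective_restrictScalars (R := R) (B := B) P
  infer_instance

lemma IsRegularAlgebra.smul_left_injective (hB : IsRegularAlgebra R B) {P : Type u} [AddCommGroup P]
    [Module R P] [Module B P] [IsScalarTower R B P] [Module.Projective B P] {f : R} (hf : f ≠ 0) :
    Function.Injective (fun p : P => f • p) := by
  have := isDomain_of_isRegularLocalRing R
  have := hB.flat P
  exact smul_right_injective P hf

lemma exists_eq_natCast_of_add_one_eq {x : WithBot ℕ∞} {m : ℕ} (h : x + 1 = m) :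
    ∃ n : ℕ, x = n := by
  induction x with
  | bot => simp at h
  | coe x =>
    induction x with
    | top => exact absurd (WithBot.coe_injective h : (⊤ + 1 : ℕ∞) = m) (by simp)
    | coe n => exact ⟨n, rfl⟩

lemma mk_mem_maximalIdeal_quotient {R : Type u} [CommRing R] [IsLocalRing R] {f r : R}
    [IsLocalRing (R ⧸ Ideal.span {f})] (hf : f ∈ maximalIdeal R) (hr : r ∈ maximalIdeal R) :
    algebraMap R (R ⧸ Ideal.span {f}) r ∈ maximalIdeal (R ⧸ Ideal.span {f}) := by
  rw [mem_maximalIdeal, mem_nonunits_iff]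
  intro h
  obtain ⟨s, hs⟩ := h.exists_right_inv
  obtain ⟨s, rfl⟩ := Ideal.Quotient.mk_surjective s
  have h1 : r * s - 1 ∈ Ideal.span {f} := Ideal.Quotient.eq.1 hs
  have h2 : r * s - 1 ∈ maximalIdeal R := (Ideal.span_singleton_le_iff_mem _).2 hf h1
  have h3 := sub_mem (Ideal.mul_mem_right s _ hr) h2
  rw [sub_sub_cancel] at h3
  exact (mem_maximalIdeal 1).1 h3 isUnit_one

lemma mem_maximalIdeal_of_mk_mem {R : Type u} [CommRing R] [IsLocalRing R] {I : Ideal R} {r : R}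
    [IsLocalRing (R ⧸ I)] (hr : algebraMap R (R ⧸ I) r ∈ maximalIdeal (R ⧸ I)) :
    r ∈ maximalIdeal R :=
  (mem_maximalIdeal r).2 fun h => (mem_maximalIdeal _).1 hr (h.map _)

variable {f : R}

lemma IsRegularAlgebra.zEven_injective (hB : IsRegularAlgebra R B) (hf : f ≠ 0) {M : Type u}
    [AddCommGroup M] [Module (Lam R B f) M] [Module.Projective B (Even R B f M)] :
    Function.Injective (zEven R B f M) := fun a b h =>
  hB.smul_left_injective hf (by
    change f • a = f • b
    rw [← zOdd_zEven, ← zOdd_zEven, h])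

/-- The even and the odd part of a module over `Λ` are finite and projective over `B`. -/
structure EvenOddProjective (R : Type u) [CommRing R] (B : Type u) [Ring B] [Algebra R B] (f : R)
    (M : Type u) [AddCommGroup M] [Module (Lam R B f) M] : Prop where
  finite_even : Module.Finite B (Even R B f M)
  finite_odd : Module.Finite B (Odd R B f M)
  projective_even : Module.Projective B (Even R B f M)
  projective_odd : Module.Projective B (Odd R B f M)

/-- A module over `Λ` is maximal Cohen-Macaulay if and only if its even and odd parts are finite
projective over `B`, that is, if it is given by a matrix factorization of `f`. -/
lemma IsRegularAlgebra.isMCM_lam_iff (hB : IsRegularAlgebra R B) (h2 : IsUnit (2 : R))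
    (M : ModuleCat.{u} (Lam R B f)) :
    isMCM R (Lam R B f) M ↔ EvenOddProjective R B f M := by
  have := hB.finite
  let _ : Module R M := Module.compHom M (algebraMap R (Lam R B f))
  let _ : Module B M := Module.compHom M (inclB R B f)
  have : IsScalarTower R (Lam R B f) M := .of_algebraMap_smul fun _ _ => rfl
  have : IsScalarTower R B M := .of_algebraMap_smul fun r m => by
    change inclB R B f (algebraMap R B r) • m = algebraMap R (Lam R B f) r • m
    rw [inclB_algebraMap]
  let e : M ≃ₗ[B] Even R B f M × Odd R B f M := evenOddLinearEquiv (fun _ _ => rfl) h2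
  obtain ⟨n, hn⟩ := exists_natCast_eq_ringKrullDim R
  constructor
  · rintro ⟨hfin, hM⟩
    have : Module.Finite (Lam R B f) M := hfin
    have : Module.Finite R M := Module.Finite.trans (Lam R B f) M
    have : Module.Finite B M := Module.Finite.of_restrictScalars_finite R B M
    have hproj : Module.Projective B M := by
      obtain ⟨rs, h1, h3, h4⟩ : ∃ rs : List R, n ≤ rs.length ∧ (∀ r ∈ rs, r ∈ maximalIdeal R) ∧
          IsWeaklyRegular M rs := by
        rcases hM with hM | hM
        · obtain ⟨rs, h1, h3, -⟩ := exists_isWeaklyRegular_of_flat hn R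
          exact ⟨rs, h1.ge, h3, ⟨fun i _ => Function.injective_of_subsingleton _⟩⟩
        · exact exists_isWeaklyRegular_of_depth_eq (R := R) (M := M) (hM.trans hn)
      exact hB.projective_of_isWeaklyRegular rs h3 h4 (by rw [hn]; exact_mod_cast h1)
    exact
      { finite_even := Module.Finite.of_surjective (LinearMap.fst _ _ _ ∘ₗ e.toLinearMap)
          (Prod.fst_surjective.comp e.surjective)
        finite_odd := Module.Finite.of_surjective (LinearMap.snd _ _ _ ∘ₗ e.toLinearMap)
          (Prod.snd_surjective.comp e.surjective)
        projective_even := .of_split (e.symm.toLinearMap ∘ₗ LinearMap.inl _ _ _)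
          (LinearMap.fst _ _ _ ∘ₗ e.toLinearMap) (by ext x; simp)
        projective_odd := .of_split (e.symm.toLinearMap ∘ₗ LinearMap.inr _ _ _)
          (LinearMap.snd _ _ _ ∘ₗ e.toLinearMap) (by ext x; simp) }
  · rintro ⟨_, _, _, _⟩
    have : Module.Projective B M := .of_equiv' e.symm
    have : Module.Finite B M := Module.Finite.equiv e.symm
    have : Module.Finite R M := Module.Finite.trans B M
    have : Module.Flat R M := hB.flat M
    refine ⟨Module.Finite.of_restrictScalars_finite R _ M, ?_⟩
    rcases subsingleton_or_nontrivial M with hM | hM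
    · exact .inl hM
    obtain ⟨rs, h1, h3, h4⟩ := exists_isWeaklyRegular_of_flat hn M
    exact .inr (depth_eq_ringKrullDim_of_isWeaklyRegular (by rw [h1, hn]) h3 h4)

lemma mem_maximalIdeal_of_nontrivial {R : Type u} [CommRing R] [IsLocalRing R] {B : Type u}
    [Ring B] [Algebra R B] {f : R} (N : Type u) [AddCommGroup N]
    [Module (HypersurfaceQuotient R B f) N] [Nontrivial N] : f ∈ maximalIdeal R := by
  refine (mem_maximalIdeal f).2 fun h => ?_
  have h0 : (Ideal.Quotient.mk (Ideal.span {algebraMap R B f}) (algebraMap R B f)) = 0 :=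
    Ideal.Quotient.eq_zero_iff_mem.2 (Ideal.mem_span_singleton_self _)
  have h1 := (h.map (algebraMap R B)).map (Ideal.Quotient.mk (Ideal.span {algebraMap R B f}))
  rw [h0, isUnit_zero_iff] at h1
  have := subsingleton_of_zero_eq_one h1
  exact not_subsingleton N (Module.subsingleton (HypersurfaceQuotient R B f) N)

/-- An `A`-module that is the cokernel of an injection of finite projective `B`-modules is maximal
Cohen-Macaulay. If `f` is a unit, then `A = 0` and the module is zero. -/
lemma IsRegularAlgebra.isMCM_of_exact (hB : IsRegularAlgebra R B) (hf : f ≠ 0) {M₀ M₁ : Type u}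
    [AddCommGroup M₀] [Module R M₀] [Module B M₀] [IsScalarTower R B M₀]
    [AddCommGroup M₁] [Module R M₁] [Module B M₁] [IsScalarTower R B M₁]
    [Module.Finite B M₀] [Module.Projective B M₀] [Module.Finite B M₁] [Module.Projective B M₁]
    (N : ModuleCat.{u} (HypersurfaceQuotient R B f)) {φ : M₀ →ₗ[B] M₁} {π : M₁ →+ N}
    (hφ : Function.Injective φ)
    (hπB : ∀ (b : B) m, π (b • m) = (Ideal.Quotient.mk _ b : HypersurfaceQuotient R B f) • π m)
    (hφπ : Function.Exact φ π) (hπ : Function.Surjective π) :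
    isMCM (R ⧸ Ideal.span {f}) (HypersurfaceQuotient R B f) N := by
  have := hB.finite
  have := isDomain_of_isRegularLocalRing R
  let _ : Module (R ⧸ Ideal.span {f}) N :=
    Module.compHom N (algebraMap (R ⧸ Ideal.span {f}) (HypersurfaceQuotient R B f))
  let _ : Module B N := Module.compHom N (Ideal.Quotient.mk (Ideal.span {algebraMap R B f}))
  let _ : Module R N := Module.compHom N (algebraMap R B)
  have : IsScalarTower R B N := .of_algebraMap_smul fun _ _ => rfl
  have : IsScalarTower R (R ⧸ Ideal.span {f}) N := .of_algebraMap_smul fun _ _ => rfl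
  let π' : M₁ →ₗ[B] N := { π with map_smul' := hπB }
  have : Module.Finite B N := Module.Finite.of_surjective π' hπ
  have : Module.Finite R N := Module.Finite.trans B N
  have : Module.Finite (R ⧸ Ideal.span {f}) N := Module.Finite.of_restrictScalars_finite R _ N
  refine ⟨?_, ?_⟩
  · obtain ⟨s, hs⟩ := (Module.Finite.fg_top : (⊤ : Submodule B N).FG)
    refine ⟨⟨s, eq_top_iff.2 fun x _ => ?_⟩⟩
    have hx : x ∈ Submodule.span B (s : Set N) := hs ▸ trivial
    induction hx using Submodule.span_induction with
    | mem x hx => exact Submodule.subset_span hx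
    | zero => exact zero_mem _
    | add x y _ _ hx hy => exact add_mem (hx trivial) (hy trivial)
    | smul b x _ hx => exact Submodule.smul_mem _ (Ideal.Quotient.mk _ b) (hx trivial)
  rcases subsingleton_or_nontrivial N with hN | hN
  · exact .inl hN
  right
  have hfm : f ∈ maximalIdeal R := mem_maximalIdeal_of_nontrivial (B := B) N
  have : Nontrivial (R ⧸ Ideal.span {f}) := Ideal.Quotient.nontrivial_iff.2 fun h =>
    (mem_maximalIdeal f).1 hfm (Ideal.span_singleton_eq_top.1 h)
  have : IsLocalRing (R ⧸ Ideal.span {f}) :=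
    .of_surjective' (Ideal.Quotient.mk _) Ideal.Quotient.mk_surjective
  have hdim := ringKrullDim_quotient_span_singleton_succ_eq_ringKrullDim
    (IsSMulRegular.of_ne_zero hf) hfm
  obtain ⟨n, hn⟩ : ∃ n : ℕ, ringKrullDim (R ⧸ Ideal.span {f}) = n := by
    obtain ⟨m, hm⟩ := exists_natCast_eq_ringKrullDim R
    exact exists_eq_natCast_of_add_one_eq (hdim.trans hm)
  rw [hn] at hdim
  have : Module.Finite R M₀ := Module.Finite.trans B M₀
  have : Module.Finite R M₁ := Module.Finite.trans B M₁
  have : Module.Flat R M₀ := hB.flat M₀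
  have : Module.Flat R M₁ := hB.flat M₁
  obtain ⟨rs, h1, h3, h4⟩ := exists_isWeaklyRegular_of_exact (n := n) (by rw [← hdim]; norm_cast)
    (φ := φ.restrictScalars R) (π := π'.restrictScalars R) hφ hφπ hπ
  refine depth_eq_ringKrullDim_of_isWeaklyRegular
    (rs := rs.map (algebraMap R (R ⧸ Ideal.span {f}))) (by rw [List.length_map, h1, hn]) ?_
    ((isWeaklyRegular_map_algebraMap_iff _ N rs).2 h4)
  intro r hr
  obtain ⟨r, hr', rfl⟩ := List.mem_map.1 hr
  exact mk_mem_maximalIdeal_quotient hfm (h3 r hr')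

/-- A surjection from a finite projective `B`-module to a maximal Cohen-Macaulay `A`-module has
projective kernel. -/
lemma IsRegularAlgebra.projective_of_isMCM (hB : IsRegularAlgebra R B) (hf : f ≠ 0) {M₁ : Type u}
    [AddCommGroup M₁] [Module B M₁] [Module.Finite B M₁] [Module.Projective B M₁]
    (N : ModuleCat.{u} (HypersurfaceQuotient R B f))
    (hN : isMCM (R ⧸ Ideal.span {f}) (HypersurfaceQuotient R B f) N) {π : M₁ →+ N}
    (hπB : ∀ (b : B) m, π (b • m) = (Ideal.Quotient.mk _ b : HypersurfaceQuotient R B f) • π m)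
    (hπ : Function.Surjective π) (K : Submodule B M₁) (hK : ∀ m, m ∈ K ↔ π m = 0) :
    Module.Projective B K := by
  have := hB.finite
  have := isDomain_of_isRegularLocalRing R
  let _ : Module (R ⧸ Ideal.span {f}) N :=
    Module.compHom N (algebraMap (R ⧸ Ideal.span {f}) (HypersurfaceQuotient R B f))
  let _ : Module B N := Module.compHom N (Ideal.Quotient.mk (Ideal.span {algebraMap R B f}))
  let _ : Module R N := Module.compHom N (algebraMap R B)
  have : IsScalarTower R B N := .of_algebraMap_smul fun _ _ => rfl
  have : IsScalarTower R (R ⧸ Ideal.span {f}) N := .of_algebraMap_smul fun _ _ => rfl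
  let π' : M₁ →ₗ[B] N := { π with map_smul' := hπB }
  have : Module.Finite B N := Module.Finite.of_surjective π' hπ
  have : Module.Finite R N := Module.Finite.trans B N
  have : Module.Finite (R ⧸ Ideal.span {f}) N := Module.Finite.of_restrictScalars_finite R _ N
  obtain rfl : K = LinearMap.ker π' := Submodule.ext hK
  obtain ⟨m, hm⟩ := exists_natCast_eq_ringKrullDim R
  rcases subsingleton_or_nontrivial N with hN' | hN'
  · obtain ⟨rs, h1, h3, -⟩ := exists_isWeaklyRegular_of_flat hm R
    refine hB.projective_ker_of_isWeaklyRegular (N := N) rs h3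
      ⟨fun i _ => Function.injective_of_subsingleton _⟩ ?_ π' hπ
    rw [hm, h1]
    exact_mod_cast Nat.le_add_left m 1
  have hfm : f ∈ maximalIdeal R := mem_maximalIdeal_of_nontrivial (B := B) N
  have : Nontrivial (R ⧸ Ideal.span {f}) := Ideal.Quotient.nontrivial_iff.2 fun h =>
    (mem_maximalIdeal f).1 hfm (Ideal.span_singleton_eq_top.1 h)
  have : IsLocalRing (R ⧸ Ideal.span {f}) :=
    .of_surjective' (Ideal.Quotient.mk _) Ideal.Quotient.mk_surjective
  have hdim := ringKrullDim_quotient_span_singleton_succ_eq_ringKrullDim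
    (IsSMulRegular.of_ne_zero hf) hfm
  obtain ⟨n, hn⟩ := exists_eq_natCast_of_add_one_eq (hdim.trans hm)
  have hd : depth (R ⧸ Ideal.span {f}) N = n :=
    ((hN.2.resolve_left (not_subsingleton N))).trans hn
  obtain ⟨rs, h1, h3, h4⟩ := exists_isWeaklyRegular_of_depth_eq hd
  obtain ⟨rs, rfl⟩ : ∃ rs' : List R, rs'.map (algebraMap R (R ⧸ Ideal.span {f})) = rs :=
    List.map_surjective_iff.2 Ideal.Quotient.mk_surjective rs
  refine hB.projective_ker_of_isWeaklyRegular rs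
    (fun r hr => mem_maximalIdeal_of_mk_mem (h3 _ (List.mem_map_of_mem hr)))
    ((isWeaklyRegular_map_algebraMap_iff _ N rs).1 h4) ?_ π' hπ
  rw [List.length_map] at h1
  rw [← hdim, hn]
  norm_cast
  omega

end MaximalCohenMacaulay

/-! ### Full, faithful and dense -/

section Equivalence

variable {R : Type u} [CommRing R] [IsRegularLocalRing R] {B : Type u} [Ring B] [Algebra R B]
  {f : R}

lemma IsRegularAlgebra.isMCM_stableHom (hB : IsRegularAlgebra R B) (hf : f ≠ 0)
    (h2 : IsUnit (2 : R)) (M : Type u) [AddCommGroup M] [Module (Lam R B f) M]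
    (hM : EvenOddProjective R B f M) :
    isMCM (R ⧸ Ideal.span {f}) (HypersurfaceQuotient R B f)
      (ModuleCat.of _ (StableHom R B f M)) := by
  obtain ⟨_, _, _, _⟩ := hM
  have hmk : ∀ m, (LinearMap.range (zEven R B f M)).mkQ m = 0 ↔ m ∈ Set.range (zEven R B f M) :=
    fun m => Submodule.Quotient.mk_eq_zero _
  refine hB.isMCM_of_exact hf (φ := zEven R B f M)
    (π := (stableHomEquiv R B f M h2).symm.toAddMonoidHom.comp
      (LinearMap.range (zEven R B f M)).mkQ.toAddMonoidHom) _ (hB.zEven_injective hf) ?_ ?_ ?_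
  · exact fun b m => stableHomEquiv_symm_smul h2 b (Submodule.Quotient.mk m)
  · intro m
    exact (map_eq_zero_iff (stableHomEquiv R B f M h2).symm (AddEquiv.injective _)).trans (hmk m)
  · exact (stableHomEquiv R B f M h2).symm.surjective.comp (Submodule.mkQ_surjective _)

section Hom

variable {M N : Type u} [AddCommGroup M] [Module (Lam R B f) M] [AddCommGroup N]
  [Module (Lam R B f) N]

/-- The functor is full: an `A`-linear map of cokernels lifts to the odd parts, as they are
projective, and then restricts to the even parts. -/
lemma IsRegularAlgebra.exists_stableHomMap_eq (hB : IsRegularAlgebra R B) (hf : f ≠ 0)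
    (h2 : IsUnit (2 : R)) (hM : EvenOddProjective R B f M) (hN : EvenOddProjective R B f N)
    (h : StableHom R B f M →ₗ[HypersurfaceQuotient R B f] StableHom R B f N) :
    ∃ g : M →ₗ[Lam R B f] N, stableHomMap R B f g = h := by
  have := hM.projective_odd
  have := hN.projective_even
  have hz := hB.zEven_injective hf (M := N)
  -- the map of the odd part of `M` to the cokernel for `N` that is to be lifted
  let k : Odd R B f M →ₗ[B] OddCoker R B f N :=
    { toFun := fun m => stableHomEquiv R B f N h2
        (h ((stableHomEquiv R B f M h2).symm (Submodule.Quotient.mk m)))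
      map_add' := fun a b => by
        rw [Submodule.Quotient.mk_add, map_add, map_add, map_add]
      map_smul' := fun b m => by
        rw [Submodule.Quotient.mk_smul, stableHomEquiv_symm_smul, map_smul, stableHomEquiv_smul]
        rfl }
  obtain ⟨g₁, hg₁⟩ := Module.projective_lifting_property
    (LinearMap.range (zEven R B f N)).mkQ k (Submodule.mkQ_surjective _)
  have hg₁' : ∀ m, Submodule.Quotient.mk (g₁ m) = k m := fun m => LinearMap.congr_fun hg₁ m
  have hrange : ∀ m, g₁ (zEven R B f M m) ∈ LinearMap.range (zEven R B f N) := fun m => by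
    refine (Submodule.Quotient.mk_eq_zero _).1 ((hg₁' _).trans ?_)
    have h0 : (Submodule.Quotient.mk (zEven R B f M m) : OddCoker R B f M) = 0 :=
      (Submodule.Quotient.mk_eq_zero _).2 ⟨m, rfl⟩
    change stableHomEquiv R B f N h2 (h ((stableHomEquiv R B f M h2).symm
      (Submodule.Quotient.mk (zEven R B f M m)))) = 0
    rw [h0, map_zero, map_zero, map_zero]
  let g₀ : Even R B f M →ₗ[B] Even R B f N :=
    (LinearEquiv.ofInjective (zEven R B f N) hz).symm.toLinearMap ∘ₗ
      (g₁ ∘ₗ zEven R B f M).codRestrict _ hrange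
  have hg₀ : ∀ m, zEven R B f N (g₀ m) = g₁ (zEven R B f M m) := fun m =>
    congrArg Subtype.val ((LinearEquiv.ofInjective (zEven R B f N) hz).apply_symm_apply
      ⟨g₁ (zEven R B f M m), hrange m⟩)
  have hfR : ∀ m : Odd R B f M, g₁ (f • m) = f • g₁ m := fun m => map_smul g₁ (algebraMap R B f) m
  let g := homOfEvenOdd h2 g₀ g₁ (fun m => (hg₀ m).symm) (fun m => hz (by
    rw [hg₀, zEven_zOdd, zEven_zOdd, hfR]))
  have hg : oddMap g = g₁ := LinearMap.ext fun m => Subtype.ext (by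
    have := homOfEvenOdd_add (h2 := h2) (g₀ := g₀) (g₁ := g₁) (fun m => (hg₀ m).symm)
      (fun m => hz (by rw [hg₀, zEven_zOdd, zEven_zOdd, hfR])) 0 m
    simpa using this)
  refine ⟨g, LinearMap.ext fun x => (stableHomEquiv R B f N h2).injective ?_⟩
  obtain ⟨y, rfl⟩ := (stableHomEquiv R B f M h2).symm.surjective x
  obtain ⟨m, rfl⟩ := Submodule.Quotient.mk_surjective _ y
  rw [stableHomEquiv_map, hg, hg₁']
  rfl

/-- The functor is faithful: a map `g` that vanishes on cokernels is homotopic to zero, by a map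
`s` from the odd to the even part with `g = sz` and `g = zs` on the even and the odd part, and `s`
is a sum of maps of rank one. -/
lemma IsRegularAlgebra.mem_throughIdeal_of_stableHomMap_eq_zero (hB : IsRegularAlgebra R B)
    (hf : f ≠ 0) (h2 : IsUnit (2 : R)) (hN : EvenOddProjective R B f N)
    {g : M →ₗ[Lam R B f] N} (hg : stableHomMap R B f g = 0) :
    g ∈ throughIdeal (LamOneSubEps R B f) M N := by
  have := hN.projective_even
  have := hN.finite_even
  have hz := hB.zEven_injective hf (M := N)
  have hrange : ∀ m, oddMap g m ∈ LinearMap.range (zEven R B f N) := fun m => by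
    have := stableHomEquiv_map h2 g m
    rw [hg, LinearMap.zero_apply, map_zero] at this
    exact (Submodule.Quotient.mk_eq_zero _).1 this.symm
  -- the homotopy
  let s : Odd R B f M →ₗ[B] Even R B f N :=
    (LinearEquiv.ofInjective (zEven R B f N) hz).symm.toLinearMap ∘ₗ
      (oddMap g).codRestrict _ hrange
  have hs : ∀ m, zEven R B f N (s m) = oddMap g m := fun m =>
    congrArg Subtype.val ((LinearEquiv.ofInjective (zEven R B f N) hz).apply_symm_apply
      ⟨oddMap g m, hrange m⟩)
  have hs' : ∀ m, s (zEven R B f M m) = evenMap g m := fun m => hz (by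
    rw [hs]
    exact Subtype.ext (map_smul g (zLam R B f) (m : M)))
  obtain ⟨n, p, i, -, -, hpi⟩ := Module.Finite.exists_comp_eq_id_of_projective B (Even R B f N)
  -- `e` and the coordinates of `i` form a dual basis of the even part of `N`
  let e : Fin n → Even R B f N := fun j => p (Pi.single j 1)
  have hp : ∀ x, x = ∑ j, i x j • e j := fun x => by
    conv_lhs => rw [← LinearMap.id_apply (R := B) x, ← hpi, LinearMap.comp_apply]
    rw [← Finset.univ_sum_single (i x), map_sum]
    refine Finset.sum_congr rfl fun j _ => ?_
    rw [← map_smul, ← Pi.single_smul, Finset.univ_sum_single, smul_eq_mul, mul_one]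
  have hgsum : g = ∑ j, homOfEven (e j) ∘ₗ homOfDualOdd h2 (LinearMap.proj j ∘ₗ i ∘ₗ s) := by
    refine LinearMap.ext fun m => ?_
    obtain ⟨⟨m₀, m₁⟩, rfl⟩ := (evenOddEquiv R B f M h2).symm.surjective m
    have hterm : ∀ j, (homOfEven (e j) ∘ₗ homOfDualOdd h2 (LinearMap.proj j ∘ₗ i ∘ₗ s))
        ((m₀ : M) + m₁) = ((i (s (zEven R B f M m₀)) j • e j : Even R B f N) : N) +
          (i (s m₁) j • zEven R B f N (e j) : Odd R B f N) := fun j => by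
      rw [LinearMap.comp_apply, homOfDualOdd_add, map_add, map_smul, map_smul, map_smul,
        homOfEven_oneSubEpsMem]
      rfl
    rw [evenOddEquiv_symm_apply, LinearMap.sum_apply, Finset.sum_congr rfl fun j _ => hterm j,
      Finset.sum_add_distrib, map_add]
    congr 1
    · refine (congrArg Subtype.val (hs' m₀)).symm.trans ?_
      conv_lhs => rw [hp (s _), AddSubgroup.val_finsetSum]
    · refine (congrArg Subtype.val (hs m₁)).symm.trans ?_
      conv_lhs => rw [hp (s _), map_sum, AddSubgroup.val_finsetSum]
      simp only [map_smul]
  rw [hgsum]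
  exact sum_mem fun j _ => comp_mem_throughIdeal _ _

end Hom

/-- The functor is dense: the kernel of a surjection from a free `B`-module to a maximal
Cohen-Macaulay `A`-module is projective, and the inclusion of the kernel is half of a matrix
factorization. -/
lemma IsRegularAlgebra.exists_linearEquiv_stableHom (hB : IsRegularAlgebra R B) (hf : f ≠ 0)
    (h2 : IsUnit (2 : R)) (N : ModuleCat.{u} (HypersurfaceQuotient R B f))
    (hN : isMCM (R ⧸ Ideal.span {f}) (HypersurfaceQuotient R B f) N) :
    ∃ M : ModuleCat.{u} (Lam R B f), EvenOddProjective R B f M ∧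
      Nonempty (StableHom R B f M ≃ₗ[HypersurfaceQuotient R B f] N) := by
  have := hB.finite
  have : Module.Finite (HypersurfaceQuotient R B f) N := hN.1
  obtain ⟨n, p, hp⟩ := Module.Finite.exists_fin' (HypersurfaceQuotient R B f) N
  let q : (Fin n → B) →+ N := p.toAddMonoidHom.comp
    { toFun := fun v j => Ideal.Quotient.mk _ (v j)
      map_zero' := rfl
      map_add' := fun _ _ => rfl }
  have hq : Function.Surjective q := fun x => by
    obtain ⟨w, rfl⟩ := hp x
    choose v hv using fun j => Ideal.Quotient.mk_surjective (w j)
    exact ⟨v, congrArg p (funext hv)⟩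
  have hqB : ∀ (b : B) v, q (b • v) =
      (Ideal.Quotient.mk _ b : HypersurfaceQuotient R B f) • q v := fun b v =>
    map_smul p (Ideal.Quotient.mk _ b : HypersurfaceQuotient R B f)
      (fun j => Ideal.Quotient.mk _ (v j))
  let K : Submodule B (Fin n → B) :=
    { carrier := {v | q v = 0}
      zero_mem' := map_zero q
      add_mem' := fun {a b} ha hb => by
        change q (a + b) = 0
        rw [map_add, ha, hb, add_zero]
      smul_mem' := fun b v hv => by
        change q (b • v) = 0
        rw [hqB, show q v = 0 from hv, smul_zero] }
  have hfK : ∀ v, algebraMap R B f • v ∈ K := fun v => by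
    change q (algebraMap R B f • v) = 0
    rw [hqB, Ideal.Quotient.eq_zero_iff_mem.2 (Ideal.mem_span_singleton_self _), zero_smul]
  have hcomm : ∀ (b : B) (v : Fin n → B), algebraMap R B f • b • v = b • algebraMap R B f • v :=
    fun b v => by rw [← mul_smul, ← mul_smul, Algebra.commutes]
  let X : MatrixFactorization (B := B) f K (Fin n → B) :=
    { φ := K.subtype
      ψ :=
        { toFun := fun v => ⟨algebraMap R B f • v, hfK v⟩
          map_add' := fun v w => Subtype.ext (smul_add _ _ _)
          map_smul' := fun b v => Subtype.ext (hcomm b v) }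
      ψ_φ := fun v => Subtype.ext (algebraMap_smul B f (v : Fin n → B))
      φ_ψ := fun v => algebraMap_smul B f v }
  have hKproj : Module.Projective B K := hB.projective_of_isMCM hf N hN hqB hq K fun _ => Iff.rfl
  have : Module.Finite B K := by
    have : IsNoetherian R (Fin n → B) := inferInstance
    have : IsNoetherian B (Fin n → B) := isNoetherian_of_tower R this
    infer_instance
  refine ⟨ModuleCat.of _ X.Total, ⟨.equiv (X.evenEquiv h2), .equiv (X.oddEquiv h2),
    .of_equiv' (X.evenEquiv h2), .of_equiv' (X.oddEquiv h2)⟩, ⟨?_⟩⟩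
  -- the odd part is the free module, and `N` is its quotient by `z` times the even part
  let r : Odd R B f X.Total →+ N := q.comp (X.oddEquiv h2).symm.toAddEquiv.toAddMonoidHom
  have hr : ∀ m, r m = 0 ↔ m ∈ LinearMap.range (zEven R B f X.Total) := fun m => by
    obtain ⟨v, rfl⟩ := (X.oddEquiv h2).surjective m
    have hv : r (X.oddEquiv h2 v) = q v :=
      congrArg q ((X.oddEquiv h2).symm_apply_apply v)
    rw [hv]
    constructor
    · intro h
      exact ⟨X.evenEquiv h2 ⟨v, h⟩, (X.oddEquiv_φ h2 ⟨v, h⟩).symm⟩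
    · rintro ⟨w, hw⟩
      obtain ⟨w, rfl⟩ := (X.evenEquiv h2).surjective w
      rw [← X.oddEquiv_φ] at hw
      rw [← (X.oddEquiv h2).injective hw]
      exact w.2
  have hrsurj : Function.Surjective r := hq.comp (X.oddEquiv h2).symm.surjective
  have hrB : ∀ (b : B) m, r (b • m) = (Ideal.Quotient.mk _ b : HypersurfaceQuotient R B f) • r m :=
    fun b m => (congrArg q (map_smul (X.oddEquiv h2).symm b m)).trans (hqB b _)
  let r' : OddCoker R B f X.Total →+ N := QuotientAddGroup.lift _ r fun m hm => (hr m).2 hm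
  have hr' : Function.Bijective r' := by
    refine ⟨(injective_iff_map_eq_zero r').2 fun x hx => ?_, fun x => ?_⟩
    · obtain ⟨m, rfl⟩ := Submodule.Quotient.mk_surjective _ x
      exact (Submodule.Quotient.mk_eq_zero _).2 ((hr m).1 hx)
    · obtain ⟨m, rfl⟩ := hrsurj x
      exact ⟨Submodule.Quotient.mk m, rfl⟩
  refine ((stableHomEquiv R B f X.Total h2).trans (AddEquiv.ofBijective r' hr')).toLinearEquiv ?_
  intro a x
  obtain ⟨b, rfl⟩ := Ideal.Quotient.mk_surjective a
  change r' (stableHomEquiv R B f X.Total h2 _) = _ • r' (stableHomEquiv R B f X.Total h2 x)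
  rw [stableHomEquiv_smul]
  obtain ⟨m, hm⟩ := Submodule.Quotient.mk_surjective _ (stableHomEquiv R B f X.Total h2 x)
  rw [← hm]
  exact hrB b m

lemma IsRegularAlgebra.isMCM_stableHomFunctor_obj (hB : IsRegularAlgebra R B) (hf : f ≠ 0)
    (h2 : IsUnit (2 : R)) (M : StableMCMLam R B f) :
    isMCM (R ⧸ Ideal.span {f}) (HypersurfaceQuotient R B f) ((stableHomFunctor R B f).obj M) :=
  hB.isMCM_stableHom hf h2 M.as.obj ((hB.isMCM_lam_iff h2 M.as.obj).1 M.as.property)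

/-- The functor from `(MCM Λ) / ⟨B[√f]⟩` to `MCM A` is an equivalence. -/
lemma IsRegularAlgebra.isEquivalence_lift (hB : IsRegularAlgebra R B) (hf : f ≠ 0)
    (h2 : IsUnit (2 : R)) :
    ((isMCM (R ⧸ Ideal.span {f}) (HypersurfaceQuotient R B f)).lift (stableHomFunctor R B f)
      (hB.isMCM_stableHomFunctor_obj hf h2)).IsEquivalence where
  full :=
    { map_surjective := by
        intro X Y h
        obtain ⟨g, hg⟩ := hB.exists_stableHomMap_eq hf h2
          ((hB.isMCM_lam_iff h2 X.as.obj).1 X.as.property)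
          ((hB.isMCM_lam_iff h2 Y.as.obj).1 Y.as.property) h.hom.hom
        refine ⟨(CategoryTheory.Quotient.functor _).map
          (⟨ModuleCat.ofHom g⟩ : X.as ⟶ Y.as), ?_⟩
        ext x
        exact LinearMap.congr_fun hg x }
  faithful :=
    { map_injective := by
        intro X Y g h hgh
        obtain ⟨g, rfl⟩ := (CategoryTheory.Quotient.functor _).map_surjective g
        obtain ⟨h, rfl⟩ := (CategoryTheory.Quotient.functor _).map_surjective h
        refine CategoryTheory.Quotient.sound _ ?_
        refine hB.mem_throughIdeal_of_stableHomMap_eq_zero hf h2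
          ((hB.isMCM_lam_iff h2 Y.as.obj).1 Y.as.property) (LinearMap.ext fun x => ?_)
        have h1 : stableHomMap R B f g.hom.hom x = stableHomMap R B f h.hom.hom x :=
          congrArg (fun k => k.hom.hom x) hgh
        induction x using QuotientAddGroup.induction_on with | H φ => ?_
        have h2 : stableHomMap R B f (g.hom.hom - h.hom.hom) (QuotientAddGroup.mk φ) =
          stableHomMap R B f g.hom.hom (QuotientAddGroup.mk φ) -
            stableHomMap R B f h.hom.hom (QuotientAddGroup.mk φ) := rfl
        rw [h2, h1, sub_self]
        rfl }
  essSurj :=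
    { mem_essImage := by
        intro N
        obtain ⟨M, hM, ⟨e⟩⟩ := hB.exists_linearEquiv_stableHom hf h2 N.obj N.property
        exact ⟨⟨⟨M, (hB.isMCM_lam_iff h2 M).2 hM⟩⟩,
          ⟨ObjectProperty.isoMk _ e.toModuleIso⟩⟩ }

end Equivalence

/-! ### Indecomposable modules and summands of a Noetherian module -/

section Indecomposable

variable {L : Type u} [Ring L]

open Limits in
/-- A module is indecomposable if and only if it is nonzero and its endomorphism ring has only
the trivial idempotents. -/
lemma indecomposable_iff (M : ModuleCat.{u} L) :
    Indecomposable M ↔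
      Nontrivial M ∧ ∀ e : Module.End L M, IsIdempotentElem e → e = 0 ∨ e = 1 := by
  rw [Indecomposable, ModuleCat.isZero_iff_subsingleton, not_subsingleton_iff_nontrivial]
  refine and_congr_right fun _ => ⟨fun h e he => ?_, fun h Y Z φ => ?_⟩
  · have hc := LinearMap.IsIdempotentElem.isCompl he
    have φ : M ≅ ModuleCat.of L (LinearMap.range e) ⊞ ModuleCat.of L (LinearMap.ker e) :=
      (Submodule.prodEquivOfIsCompl _ _ hc).symm.toModuleIso ≪≫
        (ModuleCat.biprodIsoProd (.of L (LinearMap.range e)) (.of L (LinearMap.ker e))).symm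
    rcases h _ _ φ with h0 | h0
    · left
      have h0 : Subsingleton (LinearMap.range e) := ModuleCat.isZero_iff_subsingleton.1 h0
      exact LinearMap.range_eq_bot.1 (Submodule.subsingleton_iff_eq_bot.1 h0)
    · right
      have h0 : Subsingleton (LinearMap.ker e) := ModuleCat.isZero_iff_subsingleton.1 h0
      have hinj := LinearMap.ker_eq_bot.1 (Submodule.subsingleton_iff_eq_bot.1 h0)
      exact LinearMap.ext fun x => hinj (LinearMap.congr_fun he x)
  · let e : M ⟶ M := φ.hom ≫ biprod.fst ≫ biprod.inl ≫ φ.inv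
    have he : e ≫ e = e := by simp [e]
    rcases h e.hom (by
      have := congrArg ModuleCat.Hom.hom he
      rwa [ModuleCat.hom_comp] at this) with h0 | h0
    · left
      rw [IsZero.iff_id_eq_zero]
      have h1 : e = 0 := ModuleCat.hom_ext h0
      have h2 : 𝟙 Y = biprod.inl ≫ φ.inv ≫ e ≫ φ.hom ≫ biprod.fst := by simp [e]
      rw [h2, h1]
      simp
    · right
      rw [IsZero.iff_id_eq_zero]
      have h1 : e = 𝟙 M := ModuleCat.hom_ext h0
      have h2 : biprod.inr ≫ φ.inv ≫ e ≫ φ.hom ≫ biprod.snd = (0 : Z ⟶ Z) := by simp [e]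
      rw [h1] at h2
      simpa using h2

/-- The endomorphism ring of `M` is local, in the (noncommutative) sense that `x` or `1 - x` is
a unit for all `x`. -/
def LocalEnd (L : Type u) [Ring L] (M : Type u) [AddCommGroup M] [Module L M] : Prop :=
  Nontrivial M ∧ ∀ x : Module.End L M, IsUnit x ∨ IsUnit (1 - x)

section LocalEnd

variable {M : Type u} [AddCommGroup M] [Module L M]

lemma LocalEnd.isUnit_or_of_isUnit_add (hM : LocalEnd L M) {x y : Module.End L M}
    (h : IsUnit (x + y)) : IsUnit x ∨ IsUnit y := by
  obtain ⟨u, hu⟩ := h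
  have h1 : (↑u⁻¹ : Module.End L M) * x + ↑u⁻¹ * y = 1 := by rw [← mul_add, ← hu, Units.inv_mul]
  rcases hM.2 (↑u⁻¹ * x) with h | h
  · exact .inl ((Units.isUnit_units_mul u⁻¹ x).1 h)
  · rw [← h1, add_sub_cancel_left] at h
    exact .inr ((Units.isUnit_units_mul u⁻¹ y).1 h)

/-- If the identity of a module with local endomorphism ring is a sum of maps that factor through
`P`, then one of these maps is an automorphism. -/
lemma LocalEnd.exists_isUnit_comp (hM : LocalEnd L M) {P : Type u} [AddCommGroup P] [Module L P]
    {x : Module.End L M} (hx : IsUnit x) (hx' : x ∈ throughIdeal P M M) :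
    ∃ (a : M →ₗ[L] P) (b : P →ₗ[L] M), IsUnit (b ∘ₗ a : Module.End L M) := by
  induction hx' using AddSubgroup.closure_induction with
  | mem x h =>
    obtain ⟨a, b, rfl⟩ := h
    exact ⟨a, b, hx⟩
  | zero =>
    have := hM.1
    exact absurd hx not_isUnit_zero
  | add x y _ _ h1 h2 => exact (hM.isUnit_or_of_isUnit_add hx).elim h1 h2
  | neg x _ h => exact h (IsUnit.neg_iff x |>.1 hx)

end LocalEnd

section Summands

variable {P : Type u} [AddCommGroup P] [Module L P]

/-- The isomorphism classes of modules with local endomorphism ring that are summands of `eP`. -/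
def summandClasses (e : Module.End L P) :
    Set (_root_.Quotient (isIsomorphicSetoid (ModuleCat.{u} L))) :=
  {c | ∃ M : ModuleCat.{u} L, LocalEnd L M ∧ (∃ (a : M →ₗ[L] P) (b : P →ₗ[L] M),
    IsUnit (b ∘ₗ e ∘ₗ a : Module.End L M)) ∧ c = ⟦M⟧}

lemma summandClasses_add_subset (e₁ e₂ : Module.End L P) :
    summandClasses (e₁ + e₂) ⊆ summandClasses e₁ ∪ summandClasses e₂ := by
  rintro c ⟨M, hM, ⟨a, b, hab⟩, rfl⟩
  rw [LinearMap.add_comp, LinearMap.comp_add] at hab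
  exact (hM.isUnit_or_of_isUnit_add hab).imp (fun h => ⟨M, hM, ⟨a, b, h⟩, rfl⟩)
    (fun h => ⟨M, hM, ⟨a, b, h⟩, rfl⟩)

/-- If `e` is primitive, the only summand of `eP` with local endomorphism ring is `eP`: for
`u = b e a` invertible, `e a u⁻¹ b e` is a nonzero idempotent below `e`, hence equal to `e`. -/
lemma summandClasses_subset_singleton {e : Module.End L P} (he : IsIdempotentElem e)
    (hprim : ∀ e₁ : Module.End L P, IsIdempotentElem e₁ → e * e₁ = e₁ → e₁ * e = e₁ →
      e₁ = 0 ∨ e₁ = e) :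
    summandClasses e ⊆ {⟦ModuleCat.of L (LinearMap.range e)⟧} := by
  rintro c ⟨M, hM, ⟨a, b, u, hu⟩, rfl⟩
  have := hM.1
  have hu' : ∀ m, b (e (a m)) = u.1 m := fun m => (LinearMap.congr_fun hu m).symm
  have hee : ∀ x, e (e x) = e x := fun x => LinearMap.congr_fun he x
  have huinv : ∀ m, (u⁻¹).1 (u.1 m) = m := fun m => LinearMap.congr_fun u.inv_mul m
  let e₁ : Module.End L P := e ∘ₗ a ∘ₗ (u⁻¹).1 ∘ₗ b ∘ₗ e
  have h₁ : ∀ x, e₁ x = e (a ((u⁻¹).1 (b (e x)))) := fun x => rfl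
  have he₁ : e₁ = e := by
    refine (hprim e₁ ?_ ?_ ?_).resolve_left fun h0 => ?_
    · refine LinearMap.ext fun x => ?_
      change e₁ (e₁ x) = e₁ x
      rw [h₁ (e₁ x), h₁ x, hee, hu', huinv]
    · exact LinearMap.ext fun x => hee _
    · refine LinearMap.ext fun x => ?_
      change e₁ (e x) = e₁ x
      rw [h₁, h₁, hee]
    · obtain ⟨m, hm⟩ := exists_ne (0 : M)
      have h2 : b (e₁ (a m)) = 0 := by rw [h0, LinearMap.zero_apply, map_zero]
      rw [h₁, hu', hu', huinv] at h2
      exact hm (by rw [← huinv m, h2, map_zero])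
  refine Quotient.sound ⟨LinearEquiv.toModuleIso (LinearEquiv.ofLinearMap
    ((e ∘ₗ a).codRestrict (LinearMap.range e) fun m => ⟨a m, rfl⟩)
    ((u⁻¹).1 ∘ₗ b ∘ₗ (LinearMap.range e).subtype) ?_ ?_)⟩
  · refine LinearMap.ext fun x => Subtype.ext ?_
    obtain ⟨_, x, rfl⟩ := x
    change e (a ((u⁻¹).1 (b (e x)))) = e x
    rw [← h₁, he₁]
  · refine LinearMap.ext fun m => ?_
    change (u⁻¹).1 (b (e (a m))) = m
    rw [hu', huinv]

/-- A Noetherian module has, up to isomorphism, only finitely many summands with local endomorphism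
ring. The proof is by Noetherian induction on the kernel of `e`, which grows if `e` is written as
a sum of two orthogonal idempotents. -/
lemma finite_summandClasses [IsNoetherian L P] {e : Module.End L P} (he : IsIdempotentElem e) :
    (summandClasses e).Finite := by
  induction hK : LinearMap.ker e using WellFoundedGT.induction generalizing e with
  | ind K ih =>
  by_cases hprim : ∀ e₁ : Module.End L P, IsIdempotentElem e₁ → e * e₁ = e₁ → e₁ * e = e₁ →
      e₁ = 0 ∨ e₁ = e
  · exact (Set.finite_singleton _).subset (summandClasses_subset_singleton he hprim)
  push Not at hprim
  obtain ⟨e₁, h1, h2, h3, h4, h5⟩ := hprim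
  have key : ∀ e' : Module.End L P, IsIdempotentElem e' → e * e' = e' → e' * e = e' → e' ≠ e →
      (summandClasses e').Finite := fun e' h1 h2 h3 h5 => by
    refine ih (LinearMap.ker e') (lt_of_le_of_ne ?_ fun h => h5 ?_) h1 rfl
    · rw [← hK]
      intro x hx
      rw [LinearMap.mem_ker] at hx ⊢
      rw [← h3, Module.End.mul_apply, hx, map_zero]
    · refine LinearMap.ext fun x => ?_
      have hx : x - e' x ∈ LinearMap.ker e' := by
        rw [LinearMap.mem_ker, map_sub, ← Module.End.mul_apply, h1.eq, sub_self]
      rw [← h, ← hK, LinearMap.mem_ker, map_sub, ← Module.End.mul_apply, h2] at hx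
      exact (sub_eq_zero.1 hx).symm
  have h6 : IsIdempotentElem (e - e₁) := by
    rw [IsIdempotentElem, sub_mul, mul_sub, mul_sub, he.eq, h1.eq, h2, h3, sub_self, sub_zero]
  have := ((key e₁ h1 h2 h3 h5).union (key (e - e₁) h6 (by rw [mul_sub, he.eq, h2])
    (by rw [sub_mul, he.eq, h3]) (fun h => h4 (sub_eq_self.1 h)))).subset
      (summandClasses_add_subset _ _)
  rwa [add_sub_cancel] at this

end Summands

end Indecomposable

/-! ### Finite representation type -/

section FiniteRepresentationType

open IsLocalRing

section StableHomMap

variable {R : Type u} [CommRing R] {B : Type u} [Ring B] [Algebra R B] {f : R}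
  {M N K : Type u} [AddCommGroup M] [Module (Lam R B f) M] [AddCommGroup N] [Module (Lam R B f) N]
  [AddCommGroup K] [Module (Lam R B f) K]

lemma stableHomMap_id : stableHomMap R B f (LinearMap.id : M →ₗ[Lam R B f] M) = LinearMap.id := by
  refine LinearMap.ext fun x => ?_
  induction x using QuotientAddGroup.induction_on
  rfl

lemma stableHomMap_comp (h : N →ₗ[Lam R B f] K) (g : M →ₗ[Lam R B f] N) :
    stableHomMap R B f (h ∘ₗ g) = stableHomMap R B f h ∘ₗ stableHomMap R B f g := by
  refine LinearMap.ext fun x => ?_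
  induction x using QuotientAddGroup.induction_on
  rfl

lemma stableHomMap_sub (g h : M →ₗ[Lam R B f] N) :
    stableHomMap R B f (g - h) = stableHomMap R B f g - stableHomMap R B f h := by
  refine LinearMap.ext fun x => ?_
  induction x using QuotientAddGroup.induction_on
  rfl

/-- Mutually inverse isomorphisms induced on the stable homomorphism groups. -/
def stableHomCongr (g : M →ₗ[Lam R B f] N) (h : N →ₗ[Lam R B f] M)
    (hg : stableHomMap R B f (h ∘ₗ g) = LinearMap.id)
    (hh : stableHomMap R B f (g ∘ₗ h) = LinearMap.id) :
    StableHom R B f M ≃ₗ[HypersurfaceQuotient R B f] StableHom R B f N :=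
  LinearEquiv.ofLinearMap (stableHomMap R B f g) (stableHomMap R B f h)
    (by rw [← stableHomMap_comp, hh]) (by rw [← stableHomMap_comp, hg])

variable (R B f) in
/-- The map of isomorphism classes induced by the functor. -/
def stableHomClass : _root_.Quotient (isIsomorphicSetoid (ModuleCat.{u} (Lam R B f))) →
    _root_.Quotient (isIsomorphicSetoid (ModuleCat.{u} (HypersurfaceQuotient R B f))) :=
  Quotient.map (fun M => ModuleCat.of _ (StableHom R B f M)) (by
    rintro M N ⟨e⟩
    refine ⟨(stableHomCongr e.hom.hom e.inv.hom ?_ ?_).toModuleIso⟩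
    · rw [← ModuleCat.hom_comp, e.hom_inv_id, ModuleCat.hom_id, stableHomMap_id]
    · rw [← ModuleCat.hom_comp, e.inv_hom_id, ModuleCat.hom_id, stableHomMap_id])

/-- A summand of a matrix factorization by finite projective modules is one. -/
lemma EvenOddProjective.of_retract (hM : EvenOddProjective R B f M)
    (p : M →ₗ[Lam R B f] N) (i : N →ₗ[Lam R B f] M) (h : p ∘ₗ i = LinearMap.id) :
    EvenOddProjective R B f N := by
  obtain ⟨_, _, _, _⟩ := hM
  have h0 : evenMap p ∘ₗ evenMap i = LinearMap.id (R := B) :=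
    LinearMap.ext fun x => Subtype.ext (LinearMap.congr_fun h x.1)
  have h1 : oddMap p ∘ₗ oddMap i = LinearMap.id (R := B) :=
    LinearMap.ext fun x => Subtype.ext (LinearMap.congr_fun h x.1)
  exact
    { finite_even := .of_surjective _ (LinearMap.surjective_of_comp_eq_id _ _ h0)
      finite_odd := .of_surjective _ (LinearMap.surjective_of_comp_eq_id _ _ h1)
      projective_even := .of_split _ _ h0
      projective_odd := .of_split _ _ h1 }

end StableHomMap

variable {R : Type u} [CommRing R] [IsRegularLocalRing R] {B : Type u} [Ring B] [Algebra R B]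
  {f : R}

lemma isNoetherian_lam_of_finite [Module.Finite R B] (M : Type u) [AddCommGroup M]
    [Module (Lam R B f) M] [Module.Finite (Lam R B f) M] : IsNoetherian (Lam R B f) M := by
  have : IsNoetherian R (Lam R B f) := inferInstance
  have : IsNoetherianRing (Lam R B f) := isNoetherian_of_tower R this
  infer_instance

/-- Indecomposable maximal Cohen-Macaulay modules over `Λ` have local endomorphism rings. -/
lemma IsRegularAlgebra.localEnd_lam [IsAdicComplete (maximalIdeal R) R]
    (hB : IsRegularAlgebra R B) {M : ModuleCat.{u} (Lam R B f)} (hM : isMCM R (Lam R B f) M)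
    (hind : Indecomposable M) : LocalEnd (Lam R B f) M := by
  have := hB.finite
  obtain ⟨hnt, hM'⟩ := (indecomposable_iff M).1 hind
  refine ⟨hnt, ?_⟩
  let _ : Module R M := Module.compHom M (algebraMap R (Lam R B f))
  have : IsScalarTower R (Lam R B f) M := .of_algebraMap_smul fun _ _ => rfl
  have : SMulCommClass (Lam R B f) R M := IsScalarTower.to_smulCommClass'
  have : Module.Finite (Lam R B f) M := hM.1
  have : Module.Finite R M := Module.Finite.trans (Lam R B f) M
  obtain ⟨n, p, hp⟩ := Module.Finite.exists_fin' R M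
  have hfin : Module.Finite R (Module.End (Lam R B f) M) := by
    refine Module.Finite.of_injective
      (LinearMap.lcomp R M p ∘ₗ LinearMap.restrictScalarsₗ R (Lam R B f) M M R) ?_
    intro g h hgh
    refine LinearMap.ext fun x => ?_
    obtain ⟨v, rfl⟩ := hp x
    exact LinearMap.congr_fun hgh v
  exact fun x => isUnit_or_isUnit_one_sub (R := R) hM' x

/-- If `A` has finite representation type, then so does `Λ`: the indecomposable modules that the
functor does not annihilate are determined by their images, which are indecomposable, and the others
are summands of `Λ(1-ε)`. -/
lemma IsRegularAlgebra.hasFiniteRepresentationType_lam [IsAdicComplete (maximalIdeal R) R]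
    (hB : IsRegularAlgebra R B) (hf : f ≠ 0) (h2 : IsUnit (2 : R))
    (h : HasFiniteRepresentationType (R ⧸ Ideal.span {f}) (HypersurfaceQuotient R B f)) :
    HasFiniteRepresentationType R (Lam R B f) := by
  have := hB.finite
  have : IsNoetherian (Lam R B f) (LamOneSubEps R B f) := isNoetherian_lam_of_finite _
  let S : Set (_root_.Quotient (isIsomorphicSetoid (ModuleCat.{u} (Lam R B f)))) :=
    {c | ∃ M : ModuleCat.{u} (Lam R B f), EvenOddProjective R B f M ∧ LocalEnd (Lam R B f) M ∧
      (LinearMap.id : M →ₗ[Lam R B f] M) ∉ throughIdeal (LamOneSubEps R B f) M M ∧ c = ⟦M⟧}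
  have hS : S.Finite := by
    -- the identity modulo the ideal is invertible, as the ideal consists of non-units
    have hlift : ∀ {M : Type u} [AddCommGroup M] [Module (Lam R B f) M],
        EvenOddProjective R B f M → LocalEnd (Lam R B f) M →
        (LinearMap.id : M →ₗ[Lam R B f] M) ∉ throughIdeal (LamOneSubEps R B f) M M →
        ∀ x : Module.End (Lam R B f) M, stableHomMap R B f x = LinearMap.id → IsUnit x := by
      intro M _ _ hM hloc hid x hx
      refine (hloc.2 x).resolve_right fun ⟨u, hu⟩ => hid ?_
      have h1 : (1 - x : Module.End (Lam R B f) M) ∈ throughIdeal (LamOneSubEps R B f) M M :=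
        hB.mem_throughIdeal_of_stableHomMap_eq_zero hf h2 hM (by
          rw [stableHomMap_sub, hx, Module.End.one_eq_id, stableHomMap_id, sub_self])
      rw [← hu] at h1
      have h3 := throughIdeal_postcomp (u⁻¹).1 h1
      have h4 : (u⁻¹).1 ∘ₗ u.1 = LinearMap.id := u.inv_mul
      rwa [h4] at h3
    refine Set.Finite.of_injOn (f := stableHomClass R B f) ?_ ?_ h
    · rintro c ⟨M, hM, hloc, hid, rfl⟩
      refine ⟨ModuleCat.of _ (StableHom R B f M), hB.isMCM_stableHom hf h2 M hM,
        (indecomposable_iff _).2 ⟨?_, fun e he => ?_⟩, rfl⟩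
      · by_contra hsub
        rw [not_nontrivial_iff_subsingleton] at hsub
        exact hid (hB.mem_throughIdeal_of_stableHomMap_eq_zero hf h2 hM
          (LinearMap.ext fun x => Subsingleton.elim (α := StableHom R B f M) _ _))
      · obtain ⟨g, rfl⟩ := hB.exists_stableHomMap_eq hf h2 hM hM e
        have hunit : ∀ x : Module.End (Lam R B f) M, IsUnit x →
            IsUnit (stableHomMap R B f x :
              Module.End (HypersurfaceQuotient R B f) (StableHom R B f M)) := by
          rintro _ ⟨u, rfl⟩
          refine ⟨⟨stableHomMap R B f u.1, stableHomMap R B f (u⁻¹).1, ?_, ?_⟩, rfl⟩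
          · exact (stableHomMap_comp _ _).symm.trans
              ((congrArg _ u.mul_inv).trans stableHomMap_id)
          · exact (stableHomMap_comp _ _).symm.trans
              ((congrArg _ u.inv_mul).trans stableHomMap_id)
        rcases hloc.2 g with hg | hg
        · exact .inr ((IsIdempotentElem.iff_eq_one_of_isUnit (hunit g hg)).1 he)
        · have h3 := hunit (1 - g) hg
          rw [stableHomMap_sub, Module.End.one_eq_id, stableHomMap_id] at h3
          exact .inl (sub_eq_self.1 ((IsIdempotentElem.iff_eq_one_of_isUnit h3).1 he.one_sub))
    · rintro _ ⟨M, hM, hMloc, hMid, rfl⟩ _ ⟨N, hN, hNloc, hNid, rfl⟩ hMN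
      obtain ⟨e⟩ := Quotient.exact hMN
      obtain ⟨g, hg⟩ := hB.exists_stableHomMap_eq hf h2 hM hN e.hom.hom
      obtain ⟨k, hk⟩ := hB.exists_stableHomMap_eq hf h2 hN hM e.inv.hom
      obtain ⟨u, hu⟩ := hlift hM hMloc hMid (k ∘ₗ g) (by
        rw [stableHomMap_comp, hg, hk, ← ModuleCat.hom_comp, e.hom_inv_id]; rfl)
      obtain ⟨v, hv⟩ := hlift hN hNloc hNid (g ∘ₗ k) (by
        rw [stableHomMap_comp, hg, hk, ← ModuleCat.hom_comp, e.inv_hom_id]; rfl)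
      have hinj : Function.Injective g := by
        have : Function.Injective (k ∘ₗ g) := by
          rw [← hu]; exact ((Module.End.isUnit_iff _).1 u.isUnit).1
        exact Function.Injective.of_comp this
      have hsurj : Function.Surjective g := by
        have : Function.Surjective (g ∘ₗ k) := by
          rw [← hv]; exact ((Module.End.isUnit_iff _).1 v.isUnit).2
        exact Function.Surjective.of_comp this
      exact Quotient.sound ⟨(LinearEquiv.ofBijective g ⟨hinj, hsurj⟩).toModuleIso⟩
  refine (hS.union (finite_summandClasses (L := Lam R B f) (P := LamOneSubEps R B f)
    (e := 1) IsIdempotentElem.one)).subset ?_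
  rintro c ⟨M, hM, hind, rfl⟩
  have hloc := hB.localEnd_lam hM hind
  by_cases hid : (LinearMap.id : M →ₗ[Lam R B f] M) ∈ throughIdeal (LamOneSubEps R B f) M M
  · exact .inr ⟨M, hloc, hloc.exists_isUnit_comp isUnit_one hid, rfl⟩
  · exact .inl ⟨M, (hB.isMCM_lam_iff h2 M).1 hM, hloc, hid, rfl⟩

/-- Among the maximal Cohen-Macaulay `Λ`-modules with a given indecomposable image there is an
indecomposable one: the image of an idempotent whose kernel is maximal among the idempotents that
become the identity. -/
lemma IsRegularAlgebra.exists_indecomposable (hB : IsRegularAlgebra R B) (hf : f ≠ 0)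
    (h2 : IsUnit (2 : R)) (N : ModuleCat.{u} (HypersurfaceQuotient R B f))
    (hN : isMCM (R ⧸ Ideal.span {f}) (HypersurfaceQuotient R B f) N) (hind : Indecomposable N) :
    ∃ M : ModuleCat.{u} (Lam R B f), isMCM R (Lam R B f) M ∧ Indecomposable M ∧
      Nonempty (StableHom R B f M ≃ₗ[HypersurfaceQuotient R B f] N) := by
  have := hB.finite
  obtain ⟨M, hM, ⟨φ⟩⟩ := hB.exists_linearEquiv_stableHom hf h2 N hN
  have : Module.Finite (Lam R B f) M := ((hB.isMCM_lam_iff h2 M).2 hM).1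
  have : IsNoetherian (Lam R B f) M := isNoetherian_lam_of_finite M
  -- the kernel is maximized, as `M` is Noetherian but not Artinian
  obtain ⟨K, ⟨e, he, he1, rfl⟩, hmax⟩ := WellFounded.has_min
    (wellFounded_gt (α := Submodule (Lam R B f) M))
    {K | ∃ e : Module.End (Lam R B f) M, IsIdempotentElem e ∧ stableHomMap R B f e = LinearMap.id ∧
      LinearMap.ker e = K} ⟨_, 1, .one, stableHomMap_id, rfl⟩
  let p : M →ₗ[Lam R B f] LinearMap.range e := e.rangeRestrict
  let i : LinearMap.range e →ₗ[Lam R B f] M := (LinearMap.range e).subtype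
  have hip : i ∘ₗ p = e := rfl
  have hpi : p ∘ₗ i = LinearMap.id := by
    refine LinearMap.ext fun x => Subtype.ext ?_
    obtain ⟨_, x, rfl⟩ := x
    exact LinearMap.congr_fun he x
  let ψ : StableHom R B f (LinearMap.range e) ≃ₗ[HypersurfaceQuotient R B f] StableHom R B f M :=
    stableHomCongr i p (by rw [hpi, stableHomMap_id]) (by rw [hip, he1])
  have hproj := hM.of_retract p i hpi
  refine ⟨ModuleCat.of _ (LinearMap.range e),
    (hB.isMCM_lam_iff h2 (ModuleCat.of _ (LinearMap.range e))).2 hproj,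
    (indecomposable_iff _).2 ⟨?_, ?_⟩, ⟨ψ.trans φ⟩⟩
  · have := ((indecomposable_iff N).1 hind).1
    by_contra hsub
    rw [not_nontrivial_iff_subsingleton] at hsub
    refine not_subsingleton N ⟨fun x y => ?_⟩
    have h0 : ∀ z : StableHom R B f (LinearMap.range e), z = 0 := fun z => by
      have : stableHomMap R B f (LinearMap.id : LinearMap.range e →ₗ[Lam R B f] _) = 0 := by
        have h1 : (LinearMap.id : LinearMap.range e →ₗ[Lam R B f] LinearMap.range e) = 0 :=
          LinearMap.ext fun x => Subsingleton.elim (α := LinearMap.range e) _ _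
        rw [h1, ← sub_self LinearMap.id, stableHomMap_sub, sub_self]
      rw [stableHomMap_id] at this
      exact LinearMap.congr_fun this z
    rw [← (ψ.trans φ).apply_symm_apply x, ← (ψ.trans φ).apply_symm_apply y, 
      h0 ((ψ.trans φ).symm x), h0 ((ψ.trans φ).symm y)]
  · -- an idempotent of the image of `e` that becomes the identity is the identity
    have key : ∀ e' : Module.End (Lam R B f) (LinearMap.range e), IsIdempotentElem e' →
        stableHomMap R B f e' = LinearMap.id → e' = 1 := fun e' he' h1 => by
      have hlt := hmax (LinearMap.ker (i ∘ₗ e' ∘ₗ p)) ⟨i ∘ₗ e' ∘ₗ p, ?_, ?_, rfl⟩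
      · have hle : LinearMap.ker e ≤ LinearMap.ker (i ∘ₗ e' ∘ₗ p) := fun x hx => by
          have hpx : p x = 0 := Subtype.ext hx
          rw [LinearMap.mem_ker, LinearMap.comp_apply, LinearMap.comp_apply, hpx, map_zero,
            map_zero]
        have heq := hle.eq_of_not_lt hlt
        refine LinearMap.ext fun x => ?_
        have hx : i (x - e' x) ∈ LinearMap.ker (i ∘ₗ e' ∘ₗ p) := by
          rw [LinearMap.mem_ker, LinearMap.comp_apply, LinearMap.comp_apply,
            ← LinearMap.comp_apply p i, hpi, LinearMap.id_apply, map_sub, ← Module.End.mul_apply,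
            he'.eq, sub_self, map_zero]
        rw [← heq] at hx
        have h3 : p (i (x - e' x)) = 0 := Subtype.ext hx
        rw [← LinearMap.comp_apply p i, hpi, LinearMap.id_apply] at h3
        exact (sub_eq_zero.1 h3).symm
      · refine LinearMap.ext fun x => ?_
        change i (e' ((p ∘ₗ i) (e' (p x)))) = i (e' (p x))
        rw [hpi, LinearMap.id_apply, ← Module.End.mul_apply, he'.eq]
      · rw [stableHomMap_comp, stableHomMap_comp, h1, LinearMap.id_comp, ← stableHomMap_comp, hip,
          he1]
    intro e' he'
    let θ := (ψ.trans φ)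
    have h3 := ((indecomposable_iff N).1 hind).2
      (θ.toLinearMap ∘ₗ stableHomMap R B f e' ∘ₗ θ.symm.toLinearMap) (by
        refine LinearMap.ext fun x => ?_
        change θ (stableHomMap R B f e' (θ.symm (θ (stableHomMap R B f e' (θ.symm x))))) =
          θ (stableHomMap R B f e' (θ.symm x))
        rw [LinearEquiv.symm_apply_apply, ← LinearMap.comp_apply, ← stableHomMap_comp]
        exact congrArg (fun y => θ (stableHomMap R B f y (θ.symm x))) he')
    have h4 : ∀ z, θ (stableHomMap R B f e' z) =
        (θ.toLinearMap ∘ₗ stableHomMap R B f e' ∘ₗ θ.symm.toLinearMap) (θ z) := fun z => by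
      change _ = θ (stableHomMap R B f e' (θ.symm (θ z)))
      rw [LinearEquiv.symm_apply_apply]
    rcases h3 with h3 | h3
    · left
      have h5 := key (1 - e') he'.one_sub (by
        rw [stableHomMap_sub, Module.End.one_eq_id, stableHomMap_id, sub_eq_self]
        exact LinearMap.ext fun z => θ.injective (by
          rw [h4, h3, LinearMap.zero_apply, LinearMap.zero_apply, map_zero]))
      exact sub_eq_self.1 h5
    · right
      exact key e' he' (LinearMap.ext fun z => θ.injective (by rw [h4, h3]; rfl))

/-- If `Λ` has finite representation type, then so does `A`: every indecomposable maximal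
Cohen-Macaulay `A`-module is the image of an indecomposable one over `Λ`. -/
lemma IsRegularAlgebra.hasFiniteRepresentationType_quotient (hB : IsRegularAlgebra R B)
    (hf : f ≠ 0) (h2 : IsUnit (2 : R)) (h : HasFiniteRepresentationType R (Lam R B f)) :
    HasFiniteRepresentationType (R ⧸ Ideal.span {f}) (HypersurfaceQuotient R B f) := by
  refine (h.image (stableHomClass R B f)).subset ?_
  rintro c ⟨N, hN, hind, rfl⟩
  obtain ⟨M, hM, hMind, ⟨e⟩⟩ := hB.exists_indecomposable hf h2 N hN hind
  exact ⟨⟦M⟧, ⟨M, hM, hMind, rfl⟩, Quotient.sound ⟨e.toModuleIso⟩⟩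

end FiniteRepresentationType

end Knoerrer

end

theorem mainTheorem9
    (R : Type u) [CommRing R] [IsRegularLocalRing R]
    [IsAdicComplete (IsLocalRing.maximalIdeal R) R]
    [IsAlgClosed (IsLocalRing.ResidueField R)] [CharZero (IsLocalRing.ResidueField R)]
    (hdim : 2 ≤ ringKrullDim R)
    (B : Type u) [Ring B] [Algebra R B] (hB : Knoerrer.IsRegularAlgebra R B)
    (f : R) (hf : f ≠ 0) :
    (∃ h : ∀ M : Knoerrer.StableMCMLam R B f,
        Knoerrer.isMCM (R ⧸ Ideal.span {f}) (Knoerrer.HypersurfaceQuotient R B f)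
          ((Knoerrer.stableHomFunctor R B f).obj M),
      ((Knoerrer.isMCM (R ⧸ Ideal.span {f}) (Knoerrer.HypersurfaceQuotient R B f)).lift
        (Knoerrer.stableHomFunctor R B f) h).IsEquivalence) ∧
    (Knoerrer.HasFiniteRepresentationType (R ⧸ Ideal.span {f})
        (Knoerrer.HypersurfaceQuotient R B f) ↔
      Knoerrer.HasFiniteRepresentationType R (Knoerrer.Lam R B f)) := by
  have h2 := Knoerrer.isUnit_two R
  exact ⟨⟨hB.isMCM_stableHomFunctor_obj hf h2, hB.isEquivalence_lift hf h2⟩,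
    hB.hasFiniteRepresentationType_lam hf h2, hB.hasFiniteRepresentationType_quotient hf h2⟩
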